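/- Let $H_M, H_A, H_B$ be finite dimensional complex Hilbert spaces and let $\Phi_A:\mathbb{B}(H_M)\to\mathbb{B}(H_A)$ and $\Phi_B:\mathbb{B}(H_M)\to\mathbb{B}(H_B)$ be quantum channels, i.e. completely positive trace preserving linear maps. Then for every finite dimensional Hilbert space $H_C$ and every state $\rho=\rho_{MC}$ on $H_M\otimes H_C$ (a positive operator of trace one), $$H(A|C)_{(\Phi_A\otimes\mathrm{id}_C)(\rho)}+H(B|C)_{(\Phi_B\otimes\mathrm{id}_C)(\rho)}\ \ge\ H(M|C)_\rho+\log\frac1c .$$ Here $H(X|C)_\omega=H(\omega_{XC})-H(\omega_C)$ is the conditional entropy of a state $\omega$ on $H_X\otimes H_C$, where $\omega_C=(\mathrm{tr}_X\otimes\mathrm{id}_C)(\omega)$ and $H(\sigma)=-\mathrm{tr}(\sigma\log\sigma)$ is the von Neumann entropy. The constant $c$, which satisfies $0<c<\infty$ and does not depend on $H_C$ or $\rho$, is the completely bounded norm $$c=\big\|\Phi_B\circ\Phi_A^\dagger:S_1(H_A)\to\mathbb{B}(H_B)\big\|_{cb} =\sup_{n\ge 1}\ \sup\Big\{\big\|(\Phi_B\circ\Phi_A^\dagger\otimes\mathrm{id}_{\mathbb{M}_n})(x)\big\|_{\mathbb{B}(H_B\otimes\mathbb{C}^n)}\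 :\ \|x\|_{\mathbb{M}_n(S_1(H_A))}\le 1\Big\},$$ where $\Phi_A^\dagger$ is the adjoint of $\Phi_A$ for the trace inner product $\langle X,Y\rangle=\mathrm{tr}(X^*Y)$, and the operator space structure of the trace class $S_1(H_A)$ is given, for $x\in\mathbb{M}_n(S_1(H_A))\cong\mathbb{B}(H_A\otimes\mathbb{C}^n)$, by $$\|x\|_{\mathbb{M}_n(S_1(H_A))}=\sup\big\{\mathrm{tr}\,\big|(1\otimes u)\,x\,(1\otimes v)\big|\ :\ u,v\in\mathbb{M}_n,\ \mathrm{tr}(u^*u)=\mathrm{tr}(v^*v)=1\big\}.$$ -/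

import Mathlib

open Matrix
open scoped Kronecker ENNReal ComplexOrder

namespace ChannelUncertainty

/-- The ampliation `Φ ⊗ id` of a linear map `Φ : 𝔹(H_m) → 𝔹(H_a)` by the identity of `𝔹(H_k)`.
An operator on `H_m ⊗ H_k` is a matrix indexed by `m × k`; for fixed `p q : k` its `(p, q)` block
is the matrix `i, j ↦ X (i, p) (j, q)`, and `Φ ⊗ id` applies `Φ` to every block. -/
def ampliation {m a : Type*} (k : Type*) (Φ : Matrix m m ℂ →ₗ[ℂ] Matrix a a ℂ)
    (X : Matrix (m × k) (m × k) ℂ) : Matrix (a × k) (a × k) ℂ :=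
  Matrix.of fun s t => Φ (Matrix.of fun i j => X (i, s.2) (j, t.2)) s.1 t.1

/-- Completely positive maps: `Φ ⊗ id_{𝕄_n}` is positive for all `n`. -/
def IsCompletelyPositive {m a : Type*} (Φ : Matrix m m ℂ →ₗ[ℂ] Matrix a a ℂ) : Prop :=
  ∀ (n : ℕ) (X : Matrix (m × Fin n) (m × Fin n) ℂ),
    X.PosSemidef → (ampliation (Fin n) Φ X).PosSemidef

/-- Quantum channels: completely positive trace preserving maps. -/
structure IsQuantumChannel {m a : Type*} [Fintype m] [Fintype a]
    (Φ : Matrix m m ℂ →ₗ[ℂ] Matrix a a ℂ) : Prop where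
  completelyPositive : IsCompletelyPositive Φ
  trace_map : ∀ X : Matrix m m ℂ, (Φ X).trace = X.trace

/-- Density operators (states): positive semidefinite of trace one. -/
structure IsDensityOperator {m : Type*} [Fintype m] (ρ : Matrix m m ℂ) : Prop where
  posSemidef : ρ.PosSemidef
  trace_eq_one : ρ.trace = 1

/-- The adjoint `Φ†` with respect to the trace inner product `⟨X, Y⟩ = tr (X* Y)`, given by its
matrix entries `⟨e_ij, Φ† Y⟩ = ⟨Φ e_ij, Y⟩`. See `trace_traceAdjoint`. -/
def traceAdjoint {m a : Type*} [Fintype a] [DecidableEq m]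
    (Φ : Matrix m m ℂ →ₗ[ℂ] Matrix a a ℂ) : Matrix a a ℂ →ₗ[ℂ] Matrix m m ℂ where
  toFun Y := Matrix.of fun i j => ((Φ (Matrix.single i j 1))ᴴ * Y).trace
  map_add' Y Z := by
    ext i j
    simp [Matrix.mul_add]
  map_smul' c Y := by
    ext i j
    simp

/-- The defining property of the adjoint map. -/
theorem trace_traceAdjoint {m a : Type*} [Fintype m] [Fintype a] [DecidableEq m]
    (Φ : Matrix m m ℂ →ₗ[ℂ] Matrix a a ℂ) (X : Matrix m m ℂ) (Y : Matrix a a ℂ) :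
    (Xᴴ * traceAdjoint Φ Y).trace = ((Φ X)ᴴ * Y).trace := by
  have h : Φ X = ∑ i, ∑ j, X i j • Φ (Matrix.single i j 1) := by
    conv_lhs => rw [Matrix.matrix_eq_sum_single X]
    simp only [map_sum]
    refine Finset.sum_congr rfl fun i _ => Finset.sum_congr rfl fun j _ => ?_
    rw [← map_smul, Matrix.smul_single, smul_eq_mul, mul_one]
  rw [h]
  simp only [Matrix.conjTranspose_sum, Matrix.conjTranspose_smul, Matrix.sum_mul,
    Matrix.trace_sum, Matrix.smul_mul, Matrix.trace_smul]
  rw [Finset.sum_comm]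
  simp [Matrix.trace, Matrix.mul_apply, traceAdjoint]

/-- The partial trace `tr_m ⊗ id_c` on operators on `H_m ⊗ H_c`. -/
def partialTraceLeft {m c : Type*} [Fintype m] (X : Matrix (m × c) (m × c) ℂ) : Matrix c c ℂ :=
  Matrix.of fun p q => ∑ i, X (i, p) (i, q)

/-- The von Neumann entropy `H(ρ) = - tr (ρ log ρ)` (natural logarithm, `0 log 0 = 0`). -/
noncomputable def vonNeumannEntropy {m : Type*} [Fintype m] [DecidableEq m]
    (ρ : Matrix m m ℂ) : ℝ :=
  -((ρ * cfc Real.log ρ).trace).re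

/-- The conditional entropy `H(M|C)_ρ = H(ρ_MC) - H(ρ_C)`. -/
noncomputable def condEntropy {m c : Type*} [Fintype m] [DecidableEq m] [Fintype c]
    [DecidableEq c] (ρ : Matrix (m × c) (m × c) ℂ) : ℝ :=
  vonNeumannEntropy ρ - vonNeumannEntropy (partialTraceLeft ρ)

/-- The trace norm `‖X‖₁ = tr |X|`, with `|X| = (X* X)^{1/2}`. -/
noncomputable def traceNorm {m : Type*} [Fintype m] [DecidableEq m] (X : Matrix m m ℂ) : ℝ :=
  ((cfc Real.sqrt (Xᴴ * X)).trace).re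

/-- The Hilbert-Schmidt norm `‖X‖₂ = (tr (X* X))^{1/2}`. -/
noncomputable def hilbertSchmidtNorm {m : Type*} [Fintype m] (X : Matrix m m ℂ) : ℝ :=
  Real.sqrt ((Xᴴ * X).trace).re

/-- The operator norm on `𝔹(H_m)` (Euclidean norm on `H_m = ℂ^m`). -/
noncomputable def operatorNorm {m : Type*} [Fintype m] [DecidableEq m] (X : Matrix m m ℂ) : ℝ :=
  ‖Matrix.toEuclideanCLM (n := m) (𝕜 := ℂ) X‖

/-- The matrix norms of the operator space `S₁(H_a)`: the norm of `𝕄_n(S₁(H_a)) =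
S_∞(ℂⁿ, S₁(H_a)) = L_∞^1(𝔹(ℂⁿ) ⊆ 𝔹(H_a ⊗ ℂⁿ))`, that is the supremum of
`‖(1 ⊗ u) X (1 ⊗ v)‖₁` over `u, v ∈ 𝕄_n` of Hilbert-Schmidt norm one. -/
noncomputable def matrixNormS1 {a : Type*} [Fintype a] [DecidableEq a] (n : ℕ)
    (X : Matrix (a × Fin n) (a × Fin n) ℂ) : ℝ≥0∞ :=
  ⨆ (u : Matrix (Fin n) (Fin n) ℂ) (v : Matrix (Fin n) (Fin n) ℂ)
    (_ : hilbertSchmidtNorm u = 1) (_ : hilbertSchmidtNorm v = 1),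
    ENNReal.ofReal (traceNorm
      (((1 : Matrix a a ℂ) ⊗ₖ u) * X * ((1 : Matrix a a ℂ) ⊗ₖ v)))

/-- The completely bounded norm `‖T : S₁(H_a) → 𝔹(H_b)‖_cb`: the supremum over `n` of the norm of
`T ⊗ id : 𝕄_n(S₁(H_a)) → 𝕄_n(𝔹(H_b)) = 𝔹(H_b ⊗ ℂⁿ)`. -/
noncomputable def cbNorm {a b : Type*} [Fintype a] [DecidableEq a] [Fintype b] [DecidableEq b]
    (T : Matrix a a ℂ →ₗ[ℂ] Matrix b b ℂ) : ℝ≥0∞ :=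
  ⨆ (n : ℕ) (X : Matrix (a × Fin n) (a × Fin n) ℂ) (_ : matrixNormS1 n X ≤ 1),
    ENNReal.ofReal (operatorNorm (ampliation (Fin n) T X))

end ChannelUncertainty

namespace ChannelUncertainty

/-! Write `T` for `ΦB ∘ ΦA†`, ampliated by the identity on `C` where needed. The theorem combines an
entropy inequality, `D(ΦB ρ ‖ T(ΦA ρ)) ≤ S(ΦA ρ) - S(ρ)`, with an operator inequality, `T(Y) ≤ c · 1
⊗ tr_A Y` for `Y ≥ 0`. Since enlarging the second argument decreases relative entropy, the first
holds with `c · 1 ⊗ ρ_C` in place of `T(ΦA ρ)`. The left side is then `-S(BC) + S(C) - log c`, and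
rearranging gives the claim, because both channels preserve the marginal on `C`.

The entropy inequality is obtained at the level of resolvents of the relative modular operator,
through their variational form `relForm`. Kadison–Schwarz gives data processing under `ΦB`
(`relForm_kraus_le`). For the pair `ρ, ΦA†(Y)`, expansion in eigenbases and completing the square
bound the form by a sum of terms `p² / (y + t p)` (`relForm_le_sum`). Integration over `t ≥ 0` turns
these terms into logarithms (`sum_log_le_of_sum_resolvent_le`). Using `Y = ΦA ρ + ε` keeps all
denominators positive; `ε → 0` at the end.

For the operator inequality, the unnormalized maximally entangled projection lies in the unit ball
of `𝕄_n(S₁)`, so the Choi matrix of `T` has operator norm at most `c`. Hence `Y ↦ c tr(Y) 1 - T Y`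
has a positive semidefinite Choi matrix and is completely positive. -/

theorem exists_conjTranspose_mul_self {m : Type*} [Fintype m] [DecidableEq m] {G : Matrix m m ℂ}
    (h : G.PosSemidef) : ∃ D : Matrix m m ℂ, G = Dᴴ * D := by
  open scoped MatrixOrder in
  obtain ⟨D, hD⟩ := CStarAlgebra.nonneg_iff_eq_star_mul_self.1 h.nonneg
  exact ⟨D, hD⟩

/-! ### Choi matrices and Kraus representations -/

/-- `K` is a family of Kraus operators of `Φ`. -/
def IsKraus {m a S : Type*} [Fintype m] [Fintype S] (K : S → Matrix a m ℂ)
    (Φ : Matrix m m ℂ →ₗ[ℂ] Matrix a a ℂ) : Prop :=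
  ∀ X, Φ X = ∑ s, K s * X * (K s)ᴴ

/-- The unnormalized maximally entangled vector of `H_m ⊗ ℂⁿ` given by `e : m ≃ Fin n`. -/
def maxEntVec {m : Type*} {n : ℕ} (e : m ≃ Fin n) : m × Fin n → ℂ :=
  fun s => if e s.1 = s.2 then 1 else 0

/-- The Choi matrix of `Φ`. -/
def choi {m a : Type*} {n : ℕ} (e : m ≃ Fin n) (Φ : Matrix m m ℂ →ₗ[ℂ] Matrix a a ℂ) :
    Matrix (a × Fin n) (a × Fin n) ℂ :=
  ampliation (Fin n) Φ (vecMulVec (maxEntVec e) (star (maxEntVec e)))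

theorem choi_apply {m a : Type*} [DecidableEq m] {n : ℕ} (e : m ≃ Fin n)
    (Φ : Matrix m m ℂ →ₗ[ℂ] Matrix a a ℂ) (x y : a) (i j : m) :
    choi e Φ (x, e i) (y, e j) = Φ (Matrix.single i j 1) x y := by
  simp only [choi, ampliation, Matrix.of_apply]
  refine congrArg (fun Z => Φ Z x y) ?_
  ext k l
  simp only [Matrix.of_apply, vecMulVec_apply, maxEntVec, Pi.star_apply, Matrix.single_apply,
    e.injective.eq_iff]
  by_cases h1 : i = k <;> by_cases h2 : j = l <;> simp [h1, h2, eq_comm]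

theorem map_eq_sum_single {m a : Type*} [Fintype m] [DecidableEq m]
    (Φ : Matrix m m ℂ →ₗ[ℂ] Matrix a a ℂ) (X : Matrix m m ℂ) :
    Φ X = ∑ i, ∑ j, X i j • Φ (Matrix.single i j 1) := by
  conv_lhs => rw [Matrix.matrix_eq_sum_single X]
  simp only [map_sum]
  refine Finset.sum_congr rfl fun i _ => Finset.sum_congr rfl fun j _ => ?_
  rw [← map_smul, Matrix.smul_single, smul_eq_mul, mul_one]

/-- Choi's theorem: a map with positive semidefinite Choi matrix has Kraus operators. -/
theorem exists_isKraus_of_choi {m a : Type*} [Fintype m] [DecidableEq m] [Fintype a]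
    [DecidableEq a] {n : ℕ} (e : m ≃ Fin n) (Φ : Matrix m m ℂ →ₗ[ℂ] Matrix a a ℂ)
    (h : (choi e Φ).PosSemidef) : ∃ K : a × Fin n → Matrix a m ℂ, IsKraus K Φ := by
  obtain ⟨D, hD⟩ := exists_conjTranspose_mul_self h
  -- Factor the Choi matrix as `Dᴴ * D`; each row of `D`, conjugated and reshaped into a matrix, is
  -- one Kraus operator.
  refine ⟨fun s => Matrix.of fun x i => star (D s (x, e i)), fun X => ?_⟩
  rw [map_eq_sum_single]
  ext x y
  have key : ∀ i j, Φ (Matrix.single i j 1) x y = ∑ s, star (D s (x, e i)) * D s (y, e j) := by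
    intro i j
    rw [← choi_apply e, hD]
    simp [Matrix.mul_apply]
  simp only [Matrix.sum_apply, Matrix.smul_apply, smul_eq_mul, key, Matrix.mul_apply,
    Matrix.of_apply, conjTranspose_apply, star_star, Finset.sum_mul, Finset.mul_sum]
  calc _ = ∑ i, ∑ s, ∑ j, X i j * (star (D s (x, e i)) * D s (y, e j)) :=
        Finset.sum_congr rfl fun i _ => Finset.sum_comm
    _ = ∑ s, ∑ i, ∑ j, X i j * (star (D s (x, e i)) * D s (y, e j)) := Finset.sum_comm
    _ = _ := by
        refine Finset.sum_congr rfl fun s _ => ?_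
        rw [Finset.sum_comm]
        refine Finset.sum_congr rfl fun i _ => Finset.sum_congr rfl fun j _ => ?_
        ring

theorem IsCompletelyPositive.exists_isKraus {m a : Type*} [Fintype m] [DecidableEq m] [Fintype a]
    [DecidableEq a] {Φ : Matrix m m ℂ →ₗ[ℂ] Matrix a a ℂ} (h : IsCompletelyPositive Φ) :
    ∃ K : a × Fin (Fintype.card m) → Matrix a m ℂ, IsKraus K Φ :=
  exists_isKraus_of_choi (Fintype.equivFin m) Φ (h _ _ (posSemidef_vecMulVec_self_star _))

section Kraus

variable {m a b S R : Type*} [Fintype m] [Fintype S]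
  {K : S → Matrix a m ℂ} {Φ : Matrix m m ℂ →ₗ[ℂ] Matrix a a ℂ}

theorem IsKraus.traceAdjoint_apply [DecidableEq m] [Fintype a] (h : IsKraus K Φ)
    (Y : Matrix a a ℂ) :
    traceAdjoint Φ Y = ∑ s, (K s)ᴴ * Y * K s := by
  ext i j
  simp only [traceAdjoint, LinearMap.coe_mk, AddHom.coe_mk, Matrix.of_apply, h _,
    conjTranspose_sum, conjTranspose_mul, conjTranspose_conjTranspose, Matrix.sum_mul, trace_sum,
    Matrix.sum_apply, Matrix.conjTranspose_single, star_one]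
  refine Finset.sum_congr rfl fun s _ => ?_
  rw [Matrix.mul_assoc, Matrix.trace_mul_comm, Matrix.mul_assoc, Matrix.mul_assoc,
    Matrix.trace_single_mul, one_smul, Matrix.mul_assoc]

theorem IsKraus.comp_traceAdjoint [DecidableEq m] [Fintype a] [Fintype R]
    {L : R → Matrix b m ℂ} {Ψ : Matrix m m ℂ →ₗ[ℂ] Matrix b b ℂ} (h : IsKraus K Φ)
    (h' : IsKraus L Ψ) :
    IsKraus (fun z : R × S => L z.1 * (K z.2)ᴴ) (Ψ ∘ₗ traceAdjoint Φ) := by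
  intro Y
  simp only [LinearMap.comp_apply, h.traceAdjoint_apply, h' _, Fintype.sum_prod_type,
    Matrix.mul_sum, Matrix.sum_mul, conjTranspose_mul, conjTranspose_conjTranspose,
    Matrix.mul_assoc]

theorem IsKraus.sum_conjTranspose_mul [DecidableEq m] [Fintype a] (h : IsKraus K Φ)
    (hΦ : ∀ X, (Φ X).trace = X.trace) :
    ∑ s, (K s)ᴴ * K s = 1 := by
  ext i j
  have := hΦ (Matrix.single j i 1)
  rw [h, trace_sum] at this
  rw [Matrix.sum_apply]
  have e : ∀ s, (K s * Matrix.single j i (1 : ℂ) * (K s)ᴴ).trace = ((K s)ᴴ * K s) i j := by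
    intro s
    rw [Matrix.trace_mul_comm, ← Matrix.mul_assoc, Matrix.trace_mul_single, MulOpposite.op_one,
      one_smul]
  simp only [e] at this
  rw [this, Matrix.one_apply]
  by_cases hij : i = j
  · subst hij; simp
  · rw [if_neg hij, Matrix.trace_single_eq_of_ne _ _ _ (Ne.symm hij)]

/-- Kraus operators of the ampliation. -/
theorem IsKraus.ampliation_apply (h : IsKraus K Φ) {c : Type*} [Fintype c] [DecidableEq c]
    (X : Matrix (m × c) (m × c) ℂ) :
    ampliation c Φ X = ∑ s, (K s ⊗ₖ (1 : Matrix c c ℂ)) * X * (K s ⊗ₖ (1 : Matrix c c ℂ))ᴴ := by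
  ext ⟨x, p⟩ ⟨y, q⟩
  simp only [ampliation, Matrix.of_apply, h _, Matrix.sum_apply, Matrix.mul_apply,
    kroneckerMap_apply, conjTranspose_apply, Fintype.sum_prod_type, Matrix.one_apply, 
    mul_ite, ite_mul, mul_one, mul_zero, zero_mul, apply_ite star, star_zero]
  simp

theorem sum_conjTranspose_mul_kronecker_one {m a S : Type*} [DecidableEq m] [Fintype a] [Fintype S]
    {K : S → Matrix a m ℂ} (h : ∑ s, (K s)ᴴ * K s = 1) {c : Type*} [Fintype c]
    [DecidableEq c] :
    ∑ s, (K s ⊗ₖ (1 : Matrix c c ℂ))ᴴ * (K s ⊗ₖ (1 : Matrix c c ℂ)) = 1 := by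
  simp only [conjTranspose_kronecker, ← mul_kronecker_mul, conjTranspose_one, Matrix.mul_one]
  ext ⟨x, p⟩ ⟨y, q⟩
  have := congrFun (congrFun h x) y
  simp only [Matrix.sum_apply, kroneckerMap_apply, ← Finset.sum_mul] at this ⊢
  rw [this]
  simp only [Matrix.one_apply, Prod.mk.injEq]
  by_cases h1 : x = y <;> by_cases h2 : p = q <;> simp [h1, h2]

theorem partialTraceLeft_ampliation {m a : Type*} [Fintype m] [Fintype a]
    {Φ : Matrix m m ℂ →ₗ[ℂ] Matrix a a ℂ} (hΦ : ∀ X, (Φ X).trace = X.trace) {c : Type*}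
    (X : Matrix (m × c) (m × c) ℂ) :
    partialTraceLeft (ampliation c Φ X) = partialTraceLeft X := by
  ext p q
  exact hΦ (Matrix.of fun i j => X (i, p) (j, q))

end Kraus

/-! ### Variational form of the modular resolvent -/

/-- The quadratic form whose supremum over `X` is `⟨ρ^{1/2}, (Δ + t)⁻¹ ρ^{1/2}⟩`, where `Δ` is the
relative modular operator of `σ` and `ρ`. -/
noncomputable def relForm {m : Type*} [Fintype m] (ρ σ : Matrix m m ℂ) (t : ℝ)
    (X : Matrix m m ℂ) : ℝ :=
  2 * (ρ * X).trace.re - (σ * (X * Xᴴ)).trace.re - t * (ρ * (Xᴴ * X)).trace.re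

theorem trace_mul_mul_conjTranspose_nonneg {m n : Type*} [Fintype m] [Fintype n]
    {σ : Matrix m m ℂ} (hσ : σ.PosSemidef) (Z : Matrix m n ℂ) :
    0 ≤ (σ * (Z * Zᴴ)).trace.re := by
  rw [← Matrix.mul_assoc, Matrix.trace_mul_comm, ← Matrix.mul_assoc]
  exact (Complex.nonneg_iff.1 (hσ.conjTranspose_mul_mul_same Z).trace_nonneg).1

theorem trace_diagonal_mul_conjTranspose_mul {m a : Type*} [Fintype m] [DecidableEq m]
    [Fintype a] (p : m → ℝ) (D G : Matrix a m ℂ) :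
    (diagonal (fun i => (p i : ℂ)) * (Dᴴ * G)).trace.re
      = ∑ k, ∑ i, p i * (star (D k i) * G k i).re := by
  simp only [Matrix.trace, Matrix.diag_apply, Matrix.diagonal_mul, Complex.re_sum,
    Complex.re_ofReal_mul]
  simp only [Matrix.mul_apply, Complex.re_sum, Finset.mul_sum, conjTranspose_apply]
  exact Finset.sum_comm

theorem trace_diagonal_mul_mul_conjTranspose {m a : Type*} [Fintype m] [Fintype a]
    [DecidableEq a] (y : a → ℝ) (G : Matrix a m ℂ) :
    (diagonal (fun i => (y i : ℂ)) * (G * Gᴴ)).trace.re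
      = ∑ k, ∑ i, y k * Complex.normSq (G k i) := by
  simp only [Matrix.trace, Matrix.diag_apply, Matrix.diagonal_mul, Complex.re_sum,
    Complex.re_ofReal_mul]
  simp only [Matrix.mul_apply, Complex.re_sum, Finset.mul_sum, conjTranspose_apply]
  refine Finset.sum_congr rfl fun k _ => Finset.sum_congr rfl fun i _ => ?_
  simp [Complex.normSq_apply]

section

variable {m a S : Type*} [Fintype m] [Fintype a] [Fintype S] {K : S → Matrix a m ℂ}

theorem trace_kraus_mul (ρ : Matrix m m ℂ) (X : Matrix a a ℂ) :
    ((∑ s, K s * ρ * (K s)ᴴ) * X).trace = (ρ * ∑ s, (K s)ᴴ * X * K s).trace := by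
  simp only [Matrix.sum_mul, Matrix.mul_sum, trace_sum]
  refine Finset.sum_congr rfl fun s _ => ?_
  rw [Matrix.mul_assoc, Matrix.mul_assoc, Matrix.trace_mul_comm]
  simp only [Matrix.mul_assoc]

variable [DecidableEq m]

/-- The Kadison–Schwarz inequality for the unital map `X ↦ ∑ K* X K`, tested against `σ`. -/
theorem trace_schwarz (hK : ∑ s, (K s)ᴴ * K s = 1) {σ : Matrix m m ℂ} (hσ : σ.PosSemidef)
    (X : Matrix a a ℂ) :
    (σ * ((∑ s, (K s)ᴴ * X * K s) * (∑ s, (K s)ᴴ * X * K s)ᴴ)).trace.re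
      ≤ (σ * ∑ s, (K s)ᴴ * (X * Xᴴ) * K s).trace.re := by
  set F := ∑ s, (K s)ᴴ * X * K s with hF
  have hF' : ∑ s, (K s)ᴴ * Xᴴ * K s = Fᴴ := by
    simp [hF, conjTranspose_sum, Matrix.mul_assoc]
  -- The Schwarz defect is a sum of terms `Z * Zᴴ`; unitality `hK` collapses the quartic term to `F
  -- * Fᴴ`.
  have key : ∑ s, ((K s)ᴴ * X - F * (K s)ᴴ) * ((K s)ᴴ * X - F * (K s)ᴴ)ᴴ
      = (∑ s, (K s)ᴴ * (X * Xᴴ) * K s) - F * Fᴴ := by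
    have e : ∀ s, ((K s)ᴴ * X - F * (K s)ᴴ) * ((K s)ᴴ * X - F * (K s)ᴴ)ᴴ
        = (K s)ᴴ * (X * Xᴴ) * K s - ((K s)ᴴ * X * K s) * Fᴴ - F * ((K s)ᴴ * Xᴴ * K s)
          + F * ((K s)ᴴ * K s) * Fᴴ := by
      intro s
      simp only [conjTranspose_sub, conjTranspose_mul, conjTranspose_conjTranspose,
        Matrix.mul_sub, Matrix.sub_mul, Matrix.mul_assoc]
      abel
    simp only [e, Finset.sum_add_distrib, Finset.sum_sub_distrib, ← Matrix.sum_mul,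
      ← Matrix.mul_sum]
    rw [← hF, hF', hK, Matrix.mul_one]
    abel
  have h0 : 0 ≤ (σ * ((∑ s, (K s)ᴴ * (X * Xᴴ) * K s) - F * Fᴴ)).trace.re := by
    rw [← key, Matrix.mul_sum, trace_sum, Complex.re_sum]
    exact Finset.sum_nonneg fun s _ => trace_mul_mul_conjTranspose_nonneg hσ _
  rw [Matrix.mul_sub, trace_sub, Complex.sub_re] at h0
  linarith

/-- Data processing for the quadratic form. -/
theorem relForm_kraus_le (hK : ∑ s, (K s)ᴴ * K s = 1) {ρ σ : Matrix m m ℂ} (hρ : ρ.PosSemidef)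
    (hσ : σ.PosSemidef) {τ : Matrix a a ℂ} (hτ : (τ - ∑ s, K s * σ * (K s)ᴴ).PosSemidef)
    {t : ℝ} (ht : 0 ≤ t) (X : Matrix a a ℂ) :
    relForm (∑ s, K s * ρ * (K s)ᴴ) τ t X ≤ relForm ρ σ t (∑ s, (K s)ᴴ * X * K s) := by
  have h1 := trace_schwarz hK hσ X
  -- The `t`-term of the form carries `Xᴴ * X`, the opposite order to the `σ`-term, so Schwarz is
  -- applied to the adjoint.
  have h2 := trace_schwarz hK hρ Xᴴ
  have h3 := trace_mul_mul_conjTranspose_nonneg hτ X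
  rw [Matrix.sub_mul, trace_sub, Complex.sub_re, trace_kraus_mul] at h3
  have hF : (∑ s, (K s)ᴴ * X * K s)ᴴ = ∑ s, (K s)ᴴ * Xᴴ * K s := by
    simp [conjTranspose_sum, Matrix.mul_assoc]
  rw [← hF, conjTranspose_conjTranspose, conjTranspose_conjTranspose] at h2
  simp only [relForm, trace_kraus_mul]
  nlinarith [mul_le_mul_of_nonneg_left h2 ht]

variable [DecidableEq a]

/-- The quadratic form in eigenbases of `ρ` and `Y`. -/
theorem relForm_eq_sum (hK : ∑ s, (K s)ᴴ * K s = 1) {U : Matrix m m ℂ} {V : Matrix a a ℂ}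
    (hU : Uᴴ * U = 1) (hV : Vᴴ * V = 1) (p : m → ℝ) (y : a → ℝ) (t : ℝ) (X : Matrix m m ℂ) :
    relForm (U * diagonal (fun i => (p i : ℂ)) * Uᴴ)
        (∑ s, (K s)ᴴ * (V * diagonal (fun k => (y k : ℂ)) * Vᴴ) * K s) t X
      = ∑ s, ∑ k, ∑ i, (2 * p i * (star ((Vᴴ * K s * U) k i) * (Vᴴ * K s * X * U) k i).re
          - (y k + t * p i) * Complex.normSq ((Vᴴ * K s * X * U) k i)) := by
  have hU' : U * Uᴴ = 1 := mul_eq_one_comm.1 hU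
  have hV' : V * Vᴴ = 1 := mul_eq_one_comm.1 hV
  set P := diagonal (fun i => (p i : ℂ)) with hP
  set E := diagonal (fun k => (y k : ℂ)) with hE
  have c1 : ∀ Q : Matrix a m ℂ, V * (Vᴴ * Q) = Q := fun Q => by
    rw [← Matrix.mul_assoc, hV', Matrix.one_mul]
  have c2 : ∀ Q : Matrix m a ℂ, U * (Uᴴ * Q) = Q := fun Q => by
    rw [← Matrix.mul_assoc, hU', Matrix.one_mul]
  have e1 : (U * P * Uᴴ * X).trace
      = ∑ s, (P * ((Vᴴ * K s * U)ᴴ * (Vᴴ * K s * X * U))).trace := by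
    -- Inserting `1 = ∑ (K s)ᴴ * K s` spreads the `ρ`-terms over the Kraus index, so that all three
    -- terms depend on `X` only through the matrices `Vᴴ * K s * X * U`.
    rw [← Matrix.mul_one (U * P * Uᴴ), ← hK]
    simp only [Matrix.mul_sum, Matrix.sum_mul, trace_sum]
    refine Finset.sum_congr rfl fun s _ => ?_
    rw [Matrix.mul_assoc U P, Matrix.mul_assoc U, Matrix.mul_assoc U, Matrix.trace_mul_comm U]
    simp only [conjTranspose_mul, conjTranspose_conjTranspose, Matrix.mul_assoc, c1]
  have e2 : ((∑ s, (K s)ᴴ * (V * E * Vᴴ) * K s) * (X * Xᴴ)).trace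
      = ∑ s, (E * ((Vᴴ * K s * X * U) * (Vᴴ * K s * X * U)ᴴ)).trace := by
    simp only [Matrix.sum_mul, trace_sum]
    refine Finset.sum_congr rfl fun s _ => ?_
    rw [Matrix.mul_assoc V E, ← Matrix.mul_assoc _ V, Matrix.mul_assoc _ _ (K s),
      Matrix.mul_assoc _ _ (X * Xᴴ), Matrix.trace_mul_comm ((K s)ᴴ * V)]
    simp only [conjTranspose_mul, conjTranspose_conjTranspose, Matrix.mul_assoc, c2]
  have e3 : (U * P * Uᴴ * (Xᴴ * X)).trace
      = ∑ s, (P * ((Vᴴ * K s * X * U)ᴴ * (Vᴴ * K s * X * U))).trace := by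
    rw [← Matrix.mul_one Xᴴ, ← hK]
    simp only [Matrix.mul_sum, Matrix.sum_mul, trace_sum]
    refine Finset.sum_congr rfl fun s _ => ?_
    rw [Matrix.mul_assoc U P, Matrix.mul_assoc U, Matrix.trace_mul_comm U]
    simp only [conjTranspose_mul, conjTranspose_conjTranspose, Matrix.mul_assoc, c1]
  simp only [relForm, e1, e2, e3]
  simp only [Complex.re_sum, hP, hE, trace_diagonal_mul_conjTranspose_mul,
    trace_diagonal_mul_mul_conjTranspose, Finset.mul_sum, ← Finset.sum_sub_distrib]
  refine Finset.sum_congr rfl fun s _ => Finset.sum_congr rfl fun k _ =>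
    Finset.sum_congr rfl fun i _ => ?_
  have : (star ((Vᴴ * K s * X * U) k i) * (Vᴴ * K s * X * U) k i).re
      = Complex.normSq ((Vᴴ * K s * X * U) k i) := by
    simp [Complex.normSq_apply]
  rw [this]
  ring

/-- Completing the square, with equality at `w = p z / e`. -/
theorem two_mul_re_star_mul_sub_le {p e : ℝ} (he : 0 < e) (z w : ℂ) :
    2 * p * (star z * w).re - e * Complex.normSq w ≤ Complex.normSq z * (p ^ 2 / e) := by
  have h : 0 ≤ Complex.normSq ((p : ℂ) * z - e * w) / e :=
    div_nonneg (Complex.normSq_nonneg _) he.le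
  have h2 : Complex.normSq ((p : ℂ) * z - e * w) / e = Complex.normSq z * (p ^ 2 / e)
      - (2 * p * (star z * w).re - e * Complex.normSq w) := by
    simp only [Complex.normSq_apply, Complex.sub_re, Complex.sub_im, Complex.mul_re,
      Complex.mul_im, Complex.ofReal_re, Complex.ofReal_im, Complex.star_def, Complex.conj_re,
      Complex.conj_im]
    field_simp
    ring
  linarith

/-- The entries of `Vᴴ * K s * X * U` are coupled through the single matrix `X`; maximizing over
each entry independently can only increase the value. -/
theorem relForm_le_sum (hK : ∑ s, (K s)ᴴ * K s = 1) {U : Matrix m m ℂ} {V : Matrix a a ℂ}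
    (hU : Uᴴ * U = 1) (hV : Vᴴ * V = 1) {p : m → ℝ} (hp : ∀ i, 0 ≤ p i) {y : a → ℝ}
    (hy : ∀ k, 0 < y k) {t : ℝ} (ht : 0 ≤ t) (X : Matrix m m ℂ) :
    relForm (U * diagonal (fun i => (p i : ℂ)) * Uᴴ)
        (∑ s, (K s)ᴴ * (V * diagonal (fun k => (y k : ℂ)) * Vᴴ) * K s) t X
      ≤ ∑ s, ∑ k, ∑ i, Complex.normSq ((Vᴴ * K s * U) k i) * (p i ^ 2 / (y k + t * p i)) := by
  rw [relForm_eq_sum hK hU hV]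
  exact Finset.sum_le_sum fun s _ => Finset.sum_le_sum fun k _ => Finset.sum_le_sum fun i _ =>
    two_mul_re_star_mul_sub_le (add_pos_of_pos_of_nonneg (hy k) (mul_nonneg ht (hp i))) _ _

/-- Without Kraus operators the entries of `Zᴴ * X * W` are free, so the entrywise maximum is
attained. -/
theorem exists_relForm_eq_sum {W Z : Matrix m m ℂ} (hW : Wᴴ * W = 1) (hZ : Zᴴ * Z = 1)
    {p : m → ℝ} (hp : ∀ i, 0 ≤ p i) {y : m → ℝ} (hy : ∀ k, 0 < y k) {t : ℝ} (ht : 0 ≤ t) :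
    ∃ X, relForm (W * diagonal (fun i => (p i : ℂ)) * Wᴴ)
        (Z * diagonal (fun k => (y k : ℂ)) * Zᴴ) t X
      = ∑ k, ∑ i, Complex.normSq ((Zᴴ * W) k i) * (p i ^ 2 / (y k + t * p i)) := by
  -- The entrywise maximizer `w = p z / e` with `e = y + t p`.
  let H : Matrix m m ℂ := Matrix.of fun k i => ((p i / (y k + t * p i) : ℝ) : ℂ) * (Zᴴ * W) k i
  refine ⟨Z * H * Wᴴ, ?_⟩
  have h := relForm_eq_sum (S := Unit) (K := fun _ => (1 : Matrix m m ℂ)) (by simp) hW hZ p y t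
    (Z * H * Wᴴ)
  have e : Zᴴ * (Z * H * Wᴴ) * W = H := by
    calc Zᴴ * (Z * H * Wᴴ) * W = (Zᴴ * Z) * H * (Wᴴ * W) := by simp only [Matrix.mul_assoc]
      _ = H := by rw [hW, hZ, Matrix.one_mul, Matrix.mul_one]
  simp only [Finset.univ_unique, Finset.sum_singleton, conjTranspose_one, Matrix.one_mul,
    Matrix.mul_one, e] at h
  rw [h]
  refine Finset.sum_congr rfl fun k _ => Finset.sum_congr rfl fun i _ => ?_
  have he : y k + t * p i ≠ 0 := (add_pos_of_pos_of_nonneg (hy k) (mul_nonneg ht (hp i))).ne'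
  simp only [H, Matrix.of_apply, Complex.normSq_apply, Complex.mul_re,
    Complex.mul_im, Complex.ofReal_re, Complex.ofReal_im, Complex.star_def, Complex.conj_re,
    Complex.conj_im]
  generalize y k + t * p i = e at he
  field_simp
  ring

end

/-! ### From resolvents to logarithms -/

open Filter Topology in
theorem tendsto_mul_log_add_mul_sub_log {p y : ℝ} (hp : 0 ≤ p) :
    Tendsto (fun T : ℝ => p * (Real.log (y + T * p) - Real.log T)) atTop
      (𝓝 (p * Real.log p)) := by
  rcases hp.eq_or_lt with rfl | hp
  · simp
  refine Tendsto.const_mul p ?_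
  have h1 : Tendsto (fun T : ℝ => y / T + p) atTop (𝓝 (0 + p)) :=
    (tendsto_const_nhds.div_atTop tendsto_id).add tendsto_const_nhds
  rw [zero_add] at h1
  refine ((Real.continuousAt_log hp.ne').tendsto.comp h1).congr' ?_
  filter_upwards [h1.eventually (lt_mem_nhds hp), eventually_gt_atTop 0] with T hT hT0
  have : y + T * p = T * (y / T + p) := by field_simp
  simp only [Function.comp]
  rw [this, Real.log_mul hT0.ne' hT.ne']
  ring

theorem hasDerivAt_mul_log_add_mul {p y t : ℝ} (hp : 0 ≤ p) (hy : 0 < y) (ht : 0 ≤ t) (w : ℝ) :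
    HasDerivAt (fun T : ℝ => w * (p * Real.log (y + T * p))) (w * (p ^ 2 / (y + t * p))) t := by
  have h0 : y + t * p ≠ 0 := (add_pos_of_pos_of_nonneg hy (mul_nonneg ht hp)).ne'
  have h1 : HasDerivAt (fun T : ℝ => y + T * p) p t := by
    simpa using ((hasDerivAt_id t).mul_const p).const_add y
  exact (((h1.log h0).const_mul p).const_mul w).congr_deriv (by ring)

open Filter Topology in
/-- Integrating an inequality of resolvents `p² / (y + t p)` over `t ≥ 0`. -/
theorem sum_log_le_of_sum_resolvent_le {α β : Type*} [Fintype α] [Fintype β]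
    {w p y : α → ℝ} {w' p' y' : β → ℝ} (hp : ∀ i, 0 ≤ p i) (hy : ∀ i, 0 < y i)
    (hp' : ∀ i, 0 ≤ p' i) (hy' : ∀ i, 0 < y' i)
    (hsum : ∑ i, w i * p i = ∑ i, w' i * p' i)
    (h : ∀ t : ℝ, 0 ≤ t → ∑ i, w i * (p i ^ 2 / (y i + t * p i))
      ≤ ∑ i, w' i * (p' i ^ 2 / (y' i + t * p' i))) :
    ∑ i, w i * (p i * (Real.log (p i) - Real.log (y i)))
      ≤ ∑ i, w' i * (p' i * (Real.log (p' i) - Real.log (y' i))) := by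
  -- Each integral of `p² / (y + t p)` may diverge, so the difference of the antiderivatives `p log
  -- (y + T p)` is used instead: it is monotone, and `g 0 ≤ lim g` is the claim.
  set g : ℝ → ℝ := fun T => ∑ i, w' i * (p' i * Real.log (y' i + T * p' i))
    - ∑ i, w i * (p i * Real.log (y i + T * p i)) with hg
  have hderiv : ∀ t : ℝ, 0 ≤ t → HasDerivAt g (∑ i, w' i * (p' i ^ 2 / (y' i + t * p' i))
      - ∑ i, w i * (p i ^ 2 / (y i + t * p i))) t := by
    intro t ht
    exact (HasDerivAt.fun_sum fun i _ => hasDerivAt_mul_log_add_mul (hp' i) (hy' i) ht _).sub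
      (HasDerivAt.fun_sum fun i _ => hasDerivAt_mul_log_add_mul (hp i) (hy i) ht _)
  have hmono : MonotoneOn g (Set.Ici 0) := by
    refine monotoneOn_of_deriv_nonneg (convex_Ici 0)
      (fun t ht => (hderiv t ht).continuousAt.continuousWithinAt)
      (fun t ht => ?_) (fun t ht => ?_)
    · rw [interior_Ici] at ht
      exact (hderiv t (le_of_lt ht)).differentiableAt.differentiableWithinAt
    · rw [interior_Ici] at ht
      rw [(hderiv t (le_of_lt ht)).deriv]
      exact sub_nonneg.2 (h t (le_of_lt ht))
  have hlim : Tendsto g atTop (𝓝 (∑ i, w' i * (p' i * Real.log (p' i))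
      - ∑ i, w i * (p i * Real.log (p i)))) := by
    have := (tendsto_finsetSum Finset.univ fun i _ =>
        (tendsto_mul_log_add_mul_sub_log (y := y' i) (hp' i)).const_mul (w' i)).sub
      (tendsto_finsetSum Finset.univ fun i _ =>
        (tendsto_mul_log_add_mul_sub_log (y := y i) (hp i)).const_mul (w i))
    refine this.congr fun T => ?_
    simp only [hg, mul_sub, Finset.sum_sub_distrib, ← mul_assoc, ← Finset.sum_mul]
    -- Equal total masses cancel the two `log T` counterterms.
    rw [hsum]
    ring
  have h0 : g 0 ≤ ∑ i, w' i * (p' i * Real.log (p' i)) - ∑ i, w i * (p i * Real.log (p i)) := by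
    refine ge_of_tendsto hlim ?_
    filter_upwards [eventually_ge_atTop 0] with T hT
    exact hmono Set.self_mem_Ici hT hT
  simp only [hg, zero_mul, add_zero] at h0
  simp only [mul_sub, Finset.sum_sub_distrib]
  linarith

/-! ### Spectral decompositions and overlap weights -/

/-- Diagonalization of a positive semidefinite matrix. -/
theorem exists_diagonalization {m : Type*} [Fintype m] [DecidableEq m] {ρ : Matrix m m ℂ}
    (h : ρ.PosSemidef) : ∃ (U : Matrix m m ℂ) (p : m → ℝ), Uᴴ * U = 1 ∧ (∀ i, 0 ≤ p i) ∧
      ρ = U * diagonal (fun i => (p i : ℂ)) * Uᴴ ∧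
      ∀ f : ℝ → ℝ, cfc f ρ = U * diagonal (fun i => ((f (p i) : ℝ) : ℂ)) * Uᴴ := by
  refine ⟨h.1.eigenvectorUnitary, h.1.eigenvalues, ?_, h.eigenvalues_nonneg, ?_, fun f => ?_⟩
  · exact Unitary.coe_star_mul_self h.1.eigenvectorUnitary
  · exact h.1.spectral_theorem
  · rw [h.1.cfc_eq]
    rfl

theorem trace_unitary_conj {m : Type*} [Fintype m] [DecidableEq m] {U : Matrix m m ℂ}
    (hU : Uᴴ * U = 1) (X : Matrix m m ℂ) : (U * X * Uᴴ).trace = X.trace := by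
  rw [Matrix.trace_mul_comm, ← Matrix.mul_assoc, hU, Matrix.one_mul]

theorem vonNeumannEntropy_eq {m : Type*} [Fintype m] [DecidableEq m] {ρ U : Matrix m m ℂ}
    {p : m → ℝ} (hU : Uᴴ * U = 1) (hρ : ρ = U * diagonal (fun i => (p i : ℂ)) * Uᴴ)
    (hf : ∀ f : ℝ → ℝ, cfc f ρ = U * diagonal (fun i => ((f (p i) : ℝ) : ℂ)) * Uᴴ) :
    vonNeumannEntropy ρ = -∑ i, p i * Real.log (p i) := by
  have : ρ * cfc Real.log ρ
      = U * (diagonal (fun i => (p i : ℂ)) *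
        diagonal (fun i => ((Real.log (p i) : ℝ) : ℂ))) * Uᴴ := by
    rw [hf]
    conv_lhs => rw [hρ]
    calc _ = U * diagonal (fun i => (p i : ℂ)) * (Uᴴ * U) *
          diagonal (fun i => ((Real.log (p i) : ℝ) : ℂ)) * Uᴴ := by simp only [Matrix.mul_assoc]
      _ = _ := by rw [hU, Matrix.mul_one]; simp only [Matrix.mul_assoc]
  rw [vonNeumannEntropy, this, trace_unitary_conj hU, diagonal_mul_diagonal, trace_diagonal,
    Complex.re_sum]
  simp

/-- `∑ i, p i |(V* K U)_{k i}|²` is the `k`-th diagonal entry of `V* K ρ K* V`. -/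
theorem sum_mul_normSq {m a : Type*} [Fintype m] [DecidableEq m] [Fintype a] (p : m → ℝ)
    (G : Matrix a m ℂ) (k : a) :
    ((∑ i, Complex.normSq (G k i) * p i : ℝ) : ℂ)
      = (G * diagonal (fun i => (p i : ℂ)) * Gᴴ) k k := by
  rw [Matrix.mul_apply]
  push_cast
  refine Finset.sum_congr rfl fun i _ => ?_
  rw [Matrix.mul_diagonal, conjTranspose_apply, Complex.normSq_eq_conj_mul_self, Complex.star_def]
  ring

theorem sum_normSq_col {m a : Type*} [Fintype a] (G : Matrix a m ℂ) (i : m) :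
    ((∑ k, Complex.normSq (G k i) : ℝ) : ℂ) = (Gᴴ * G) i i := by
  rw [Matrix.mul_apply]
  push_cast
  refine Finset.sum_congr rfl fun k _ => ?_
  rw [conjTranspose_apply, Complex.normSq_eq_conj_mul_self, Complex.star_def]

theorem sum_normSq_kraus_mul {m a S : Type*} [Fintype m] [DecidableEq m] [Fintype a] [Fintype S]
    {K : S → Matrix a m ℂ} {U : Matrix m m ℂ} {V : Matrix a a ℂ} (p : m → ℝ) (k : a) :
    ∑ s, ∑ i, Complex.normSq ((Vᴴ * K s * U) k i) * p i
      = ((Vᴴ * (∑ s, K s * (U * diagonal (fun i => (p i : ℂ)) * Uᴴ) * (K s)ᴴ) * V) k k).re := by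
  have h : ((∑ s, ∑ i, Complex.normSq ((Vᴴ * K s * U) k i) * p i : ℝ) : ℂ)
      = (Vᴴ * (∑ s, K s * (U * diagonal (fun i => (p i : ℂ)) * Uᴴ) * (K s)ᴴ) * V) k k := by
    rw [Complex.ofReal_sum]
    simp only [sum_mul_normSq]
    rw [Matrix.mul_sum, Matrix.sum_mul, Matrix.sum_apply]
    simp only [conjTranspose_mul, conjTranspose_conjTranspose, Matrix.mul_assoc]
  rw [← h, Complex.ofReal_re]

theorem posSemidef_kraus {m a S : Type*} [Fintype m] [Fintype a] [Fintype S] {K : S → Matrix a m ℂ}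
    {ρ : Matrix m m ℂ} (hρ : ρ.PosSemidef) :
    (∑ s, K s * ρ * (K s)ᴴ).PosSemidef :=
  posSemidef_sum _ fun s _ => hρ.mul_mul_conjTranspose_same (K s)

section

variable {m a S : Type*} [Fintype m] [DecidableEq m] [Fintype a] [DecidableEq a] [Fintype S]
  {K : S → Matrix a m ℂ} {U : Matrix m m ℂ} {V : Matrix a a ℂ}

/-- The matrices `Vᴴ * K s * U`, stacked over `s`, form an isometry, so their columns are unit
vectors. The squared overlaps therefore act as conditional probabilities given `i`. -/
theorem sum_normSq_kraus_col (hK : ∑ s, (K s)ᴴ * K s = 1) (hU : Uᴴ * U = 1) (hV : Vᴴ * V = 1)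
    (i : m) : ∑ s, ∑ k, Complex.normSq ((Vᴴ * K s * U) k i) = 1 := by
  have hV' : V * Vᴴ = 1 := mul_eq_one_comm.1 hV
  have h : ∑ s, (Vᴴ * K s * U)ᴴ * (Vᴴ * K s * U) = 1 := by
    calc _ = ∑ s, Uᴴ * ((K s)ᴴ * (V * Vᴴ) * K s) * U := by
          simp only [conjTranspose_mul, conjTranspose_conjTranspose, Matrix.mul_assoc]
      _ = 1 := by
          simp only [hV', Matrix.mul_one]
          rw [← Matrix.sum_mul, ← Matrix.mul_sum, hK, Matrix.mul_one, hU]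
  have := congrFun (congrFun h i) i
  rw [Matrix.sum_apply, Matrix.one_apply_eq] at this
  simp only [← sum_normSq_col] at this
  exact_mod_cast this

theorem diag_conj_diagonal (hV : Vᴴ * V = 1) (y : a → ℝ) (k : a) :
    ((Vᴴ * (V * diagonal (fun i => (y i : ℂ)) * Vᴴ) * V) k k).re = y k := by
  have : Vᴴ * (V * diagonal (fun i => (y i : ℂ)) * Vᴴ) * V = diagonal (fun i => (y i : ℂ)) := by
    calc _ = (Vᴴ * V) * diagonal (fun i => (y i : ℂ)) * (Vᴴ * V) := by
          simp only [Matrix.mul_assoc]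
      _ = _ := by rw [hV, Matrix.one_mul, Matrix.mul_one]
  rw [this, diagonal_apply_eq, Complex.ofReal_re]

theorem trace_kraus (hK : ∑ s, (K s)ᴴ * K s = 1) (ρ : Matrix m m ℂ) :
    (∑ s, K s * ρ * (K s)ᴴ).trace = ρ.trace := by
  have := trace_kraus_mul (K := K) ρ 1
  simpa only [Matrix.mul_one, hK] using this

theorem sum_diag_conj (hV : Vᴴ * V = 1) (X : Matrix a a ℂ) :
    ∑ k, ((Vᴴ * X * V) k k).re = X.trace.re := by
  have : (Vᴴ * X * V).trace = X.trace := by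
    rw [Matrix.trace_mul_comm, ← Matrix.mul_assoc, mul_eq_one_comm.1 hV, Matrix.one_mul]
  rw [← this, Matrix.trace, Complex.re_sum]
  rfl

end

theorem conj_diagonal_add_smul_one {a : Type*} [Fintype a] [DecidableEq a] {V : Matrix a a ℂ}
    (hV : Vᴴ * V = 1) (y : a → ℝ) (ε : ℝ) :
    V * diagonal (fun k => (y k : ℂ)) * Vᴴ + (ε : ℂ) • (1 : Matrix a a ℂ)
      = V * diagonal (fun k => ((y k + ε : ℝ) : ℂ)) * Vᴴ := by
  have : diagonal (fun k => ((y k + ε : ℝ) : ℂ))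
      = diagonal (fun k => (y k : ℂ)) + (ε : ℂ) • (1 : Matrix a a ℂ) := by
    rw [← Matrix.diagonal_one, ← Matrix.diagonal_smul, Matrix.diagonal_add]
    congr 1
    ext k
    simp
  rw [this, Matrix.mul_add, Matrix.add_mul, Matrix.mul_smul, Matrix.smul_mul, Matrix.mul_one,
    mul_eq_one_comm.1 hV]

/-! ### Relative entropy bounded by entropy gain -/

/-- The entropic inequality behind the uncertainty relation: `D(Φ_B ρ ‖ τ) ≤ S(Φ_A ρ) - S(ρ)`
whenever `Φ_B (Φ_A† (Φ_A ρ + ε)) ≤ τ`. -/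
theorem relEntropy_le_entropy_gain {m a b S R : Type*} [Fintype m] [DecidableEq m] [Fintype a]
    [DecidableEq a] [Fintype b] [DecidableEq b] [Fintype S] [Fintype R]
    {K : S → Matrix a m ℂ} {L : R → Matrix b m ℂ} (hK : ∑ s, (K s)ᴴ * K s = 1)
    (hL : ∑ r, (L r)ᴴ * L r = 1) {ρ : Matrix m m ℂ} (hρ : ρ.PosSemidef) {ε : ℝ} (hε : 0 < ε)
    {Z : Matrix b b ℂ} (hZ : Zᴴ * Z = 1) {z : b → ℝ} (hz : ∀ k, 0 < z k)
    (hτ : (Z * diagonal (fun k => (z k : ℂ)) * Zᴴ - ∑ r, L r * (∑ s, (K s)ᴴ *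
      ((∑ s, K s * ρ * (K s)ᴴ) + (ε : ℂ) • (1 : Matrix a a ℂ)) * K s) * (L r)ᴴ).PosSemidef) :
    -vonNeumannEntropy (∑ r, L r * ρ * (L r)ᴴ)
        - ∑ k, ((Zᴴ * (∑ r, L r * ρ * (L r)ᴴ) * Z) k k).re * Real.log (z k)
      ≤ vonNeumannEntropy (∑ s, K s * ρ * (K s)ᴴ) - vonNeumannEntropy ρ := by
  obtain ⟨U, p, hU, hp, hρU, hρf⟩ := exists_diagonalization hρ
  obtain ⟨V, y, hV, hy, hAV, hAf⟩ := exists_diagonalization (posSemidef_kraus (K := K) hρ)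
  obtain ⟨W, q, hW, hq, hBW, hBf⟩ := exists_diagonalization (posSemidef_kraus (K := L) hρ)
  have hyε : ∀ k, 0 < y k + ε := fun k => add_pos_of_nonneg_of_pos (hy k) hε
  have hY : (∑ s, K s * ρ * (K s)ᴴ) + (ε : ℂ) • (1 : Matrix a a ℂ)
      = V * diagonal (fun k => ((y k + ε : ℝ) : ℂ)) * Vᴴ := by
    rw [hAV, conj_diagonal_add_smul_one hV]
  have hYpos : (V * diagonal (fun k => ((y k + ε : ℝ) : ℂ)) * Vᴴ).PosSemidef := by
    refine PosSemidef.mul_mul_conjTranspose_same (posSemidef_diagonal_iff.2 fun k => ?_) V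
    exact_mod_cast (hyε k).le
  rw [hY] at hτ
  have hσ : (∑ s, (K s)ᴴ * (V * diagonal (fun k => ((y k + ε : ℝ) : ℂ)) * Vᴴ) * K s).PosSemidef :=
    posSemidef_sum _ fun s _ => hYpos.conjTranspose_mul_mul_same (K s)
  have wB : ∀ k, ∑ i, Complex.normSq ((Zᴴ * W) k i) * q i
      = ((Zᴴ * (∑ r, L r * ρ * (L r)ᴴ) * Z) k k).re := by
    intro k
    have := sum_normSq_kraus_mul (S := Unit) (K := fun _ => (1 : Matrix b b ℂ)) (U := W) (V := Z)
      q k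
    simpa only [Finset.univ_unique, Finset.sum_singleton, conjTranspose_one, Matrix.one_mul,
      Matrix.mul_one, ← hBW] using this
  have cB : ∀ i, ∑ k, Complex.normSq ((Zᴴ * W) k i) = 1 := by
    intro i
    have := sum_normSq_kraus_col (S := Unit) (K := fun _ => (1 : Matrix b b ℂ)) (by simp) hW hZ i
    simpa only [Finset.univ_unique, Finset.sum_singleton, Matrix.mul_one] using this
  have wA : ∀ k, ∑ s, ∑ i, Complex.normSq ((Vᴴ * K s * U) k i) * p i = y k := by
    intro k
    rw [sum_normSq_kraus_mul, ← hρU, hAV, diag_conj_diagonal hV]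
  have cA := sum_normSq_kraus_col hK hU hV
  have sA : ∀ f : a → ℝ, ∑ s, ∑ k, ∑ i, Complex.normSq ((Vᴴ * K s * U) k i) * (p i * f k)
      = ∑ k, y k * f k := by
    intro f
    rw [Finset.sum_comm]
    refine Finset.sum_congr rfl fun k _ => ?_
    rw [← wA k]
    simp only [Finset.sum_mul, mul_assoc]
  -- On the left, pairs of eigenvectors of `τ` and `ΦB ρ`; on the right, a Kraus index with
  -- eigenvectors of `ΦA ρ` and `ρ`. Both total masses equal `tr ρ`.
  have main := sum_log_le_of_sum_resolvent_le (α := b × b) (β := S × a × m)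
    (w := fun x => Complex.normSq ((Zᴴ * W) x.1 x.2)) (p := fun x => q x.2) (y := fun x => z x.1)
    (w' := fun x => Complex.normSq ((Vᴴ * K x.1 * U) x.2.1 x.2.2)) (p' := fun x => p x.2.2)
    (y' := fun x => y x.2.1 + ε) (fun x => hq _) (fun x => hz _) (fun x => hp _) (fun x => hyε _)
    (by
      simp only [Fintype.sum_prod_type, wB]
      rw [sum_diag_conj hZ, trace_kraus hL, Finset.sum_comm]
      simp only [wA]
      rw [← trace_kraus hK ρ, hAV, trace_unitary_conj hV, trace_diagonal, Complex.re_sum]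
      simp)
    (by
      intro t ht
      simp only [Fintype.sum_prod_type]
      obtain ⟨X, hX⟩ := exists_relForm_eq_sum hW hZ hq hz ht
      rw [← hX, ← hBW]
      refine (relForm_kraus_le hL hρ hσ hτ ht X).trans ?_
      rw [hρU]
      exact relForm_le_sum hK hU hV hp hyε ht _)
  simp only [Fintype.sum_prod_type, mul_sub, Finset.sum_sub_distrib] at main
  rw [sA fun k => Real.log (y k + ε)] at main
  have tB : ∑ k, ∑ i, Complex.normSq ((Zᴴ * W) k i) * (q i * Real.log (q i))
      = ∑ i, q i * Real.log (q i) := by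
    rw [Finset.sum_comm]
    simp only [← Finset.sum_mul, cB, one_mul]
  have tA : ∑ s, ∑ k, ∑ i, Complex.normSq ((Vᴴ * K s * U) k i) * (p i * Real.log (p i))
      = ∑ i, p i * Real.log (p i) := by
    calc _ = ∑ i, (∑ s, ∑ k, Complex.normSq ((Vᴴ * K s * U) k i)) * (p i * Real.log (p i)) := by
          simp only [Finset.sum_mul]
          rw [Finset.sum_comm]
          simp only [Finset.sum_comm (s := (Finset.univ : Finset S))]
          exact Finset.sum_comm
      _ = _ := by simp only [cA, one_mul]
  have uB : ∑ k, ∑ i, Complex.normSq ((Zᴴ * W) k i) * (q i * Real.log (z k))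
      = ∑ k, ((Zᴴ * (∑ r, L r * ρ * (L r)ᴴ) * Z) k k).re * Real.log (z k) := by
    simp only [← mul_assoc, ← Finset.sum_mul, wB]
  -- Removes `ε` on the `A` side without a limit, by monotonicity of the logarithm.
  have hmon : ∑ k, y k * Real.log (y k) ≤ ∑ k, y k * Real.log (y k + ε) := by
    refine Finset.sum_le_sum fun k _ => ?_
    rcases (hy k).eq_or_lt with h | h
    · simp [← h]
    · exact mul_le_mul_of_nonneg_left (Real.log_le_log h (by linarith)) h.le
  rw [tA, tB, uB] at main
  rw [vonNeumannEntropy_eq hU hρU hρf, vonNeumannEntropy_eq hV hAV hAf,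
    vonNeumannEntropy_eq hW hBW hBf]
  linarith

/-! ### Trace norm estimates -/

theorem traceNorm_eq_sum {m : Type*} [Fintype m] [DecidableEq m] (X : Matrix m m ℂ) :
    ∃ (U : Matrix m m ℂ) (p : m → ℝ), Uᴴ * U = 1 ∧ (∀ i, 0 ≤ p i) ∧
      Xᴴ * X = U * diagonal (fun i => (p i : ℂ)) * Uᴴ ∧ traceNorm X = ∑ i, Real.sqrt (p i) := by
  obtain ⟨U, p, hU, hp, h, hf⟩ := exists_diagonalization (posSemidef_conjTranspose_mul_self X)
  refine ⟨U, p, hU, hp, h, ?_⟩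
  rw [traceNorm, hf, trace_unitary_conj hU, trace_diagonal, Complex.re_sum]
  simp

/-- The eigenvalues of `Xᴴ * X` are 0 or 1, hence equal to their square roots. -/
theorem traceNorm_eq_of_partial_isometry {m : Type*} [Fintype m] [DecidableEq m]
    {X : Matrix m m ℂ} (h : (Xᴴ * X) * (Xᴴ * X) = Xᴴ * X) :
    traceNorm X = (Xᴴ * X).trace.re := by
  obtain ⟨U, p, hU, hp, hX, hn⟩ := traceNorm_eq_sum X
  have hd : Uᴴ * (Xᴴ * X) * U = diagonal (fun i => (p i : ℂ)) := by
    rw [hX]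
    calc _ = (Uᴴ * U) * diagonal (fun i => (p i : ℂ)) * (Uᴴ * U) := by
          simp only [Matrix.mul_assoc]
      _ = _ := by rw [hU, Matrix.one_mul, Matrix.mul_one]
  have hsq : diagonal (fun i => (p i : ℂ)) * diagonal (fun i => (p i : ℂ))
      = diagonal (fun i => (p i : ℂ)) := by
    calc diagonal (fun i => (p i : ℂ)) * diagonal (fun i => (p i : ℂ))
        = Uᴴ * (Xᴴ * X) * (U * Uᴴ) * (Xᴴ * X) * U := by
          rw [← hd]; simp only [Matrix.mul_assoc]
      _ = Uᴴ * ((Xᴴ * X) * (Xᴴ * X)) * U := by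
          rw [mul_eq_one_comm.1 hU, Matrix.mul_one]; simp only [Matrix.mul_assoc]
      _ = _ := by rw [h, hd]
  have hp2 : ∀ i, p i * p i = p i := by
    intro i
    have := congrFun (congrFun hsq i) i
    rw [diagonal_mul_diagonal, diagonal_apply_eq, diagonal_apply_eq] at this
    exact_mod_cast this
  rw [hn, hX, trace_unitary_conj hU, trace_diagonal, Complex.re_sum]
  refine Finset.sum_congr rfl fun i _ => ?_
  rw [Complex.ofReal_re]
  conv_lhs => rw [← hp2 i]
  exact Real.sqrt_mul_self (hp i)

/-- An entry is bounded by the Hilbert–Schmidt norm, and `∑ p ≤ (∑ √p)²` bounds that by the trace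
norm. -/
theorem norm_apply_le_traceNorm {m : Type*} [Fintype m] [DecidableEq m] (X : Matrix m m ℂ)
    (s t : m) : ‖X s t‖ ≤ traceNorm X := by
  obtain ⟨U, p, hU, hp, hX, hn⟩ := traceNorm_eq_sum X
  have h1 : ∑ j, ∑ i, Complex.normSq (X i j) = ∑ i, p i := by
    have e : (Xᴴ * X).trace.re = ∑ j, ∑ i, Complex.normSq (X i j) := by
      simp only [Matrix.trace, Matrix.diag_apply, ← sum_normSq_col, Complex.re_sum,
        Complex.ofReal_re]
    rw [← e, hX, trace_unitary_conj hU, trace_diagonal, Complex.re_sum]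
    simp
  have h2 : Complex.normSq (X s t) ≤ ∑ i, p i := by
    rw [← h1]
    refine le_trans ?_ (Finset.single_le_sum (f := fun j => ∑ i, Complex.normSq (X i j))
      (fun j _ => Finset.sum_nonneg fun i _ => Complex.normSq_nonneg _) (Finset.mem_univ t))
    exact Finset.single_le_sum (f := fun i => Complex.normSq (X i t))
      (fun i _ => Complex.normSq_nonneg _) (Finset.mem_univ s)
  have h0 : ∀ i ∈ Finset.univ, 0 ≤ Real.sqrt (p i) := fun i _ => Real.sqrt_nonneg _
  have h3 : ∑ i, p i ≤ (∑ i, Real.sqrt (p i)) ^ 2 := by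
    calc ∑ i, p i = ∑ i, Real.sqrt (p i) ^ 2 := by simp only [Real.sq_sqrt (hp _)]
      _ ≤ _ := Finset.sum_sq_le_sq_sum_of_nonneg h0
  rw [hn]
  refine le_of_sq_le_sq ?_ (Finset.sum_nonneg h0)
  rw [← Complex.normSq_eq_norm_sq]
  exact h2.trans h3

theorem trace_conjTranspose_mul_self_of_hilbertSchmidtNorm {m : Type*} [Fintype m]
    {u : Matrix m m ℂ} (hu : hilbertSchmidtNorm u = 1) : (uᴴ * u).trace = 1 := by
  have h : ((uᴴ * u).trace).re = 1 := by
    rw [hilbertSchmidtNorm, Real.sqrt_eq_one] at hu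
    exact hu
  have h0 := Complex.nonneg_iff.1 (posSemidef_conjTranspose_mul_self u).trace_nonneg
  exact Complex.ext h h0.2.symm

/-! ### The Choi matrix and the completely bounded norm -/

section

variable {a b : Type*} [Fintype a] [DecidableEq a] [Fintype b] [DecidableEq b]

/-- Multiplying by `1 ⊗ u` and `1 ⊗ v` gives a rank-one matrix whose two vectors list the entries of
`u` and of `v`. Both are unit vectors, so it is a partial isometry of trace norm one. -/
theorem matrixNormS1_maxEnt_le {n : ℕ} (e : a ≃ Fin n) :
    matrixNormS1 n (vecMulVec (maxEntVec e) (star (maxEntVec e))) ≤ 1 := by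
  refine iSup_le fun u => iSup_le fun v => iSup_le fun hu => iSup_le fun hv => ?_
  rw [Matrix.mul_vecMulVec, Matrix.vecMulVec_mul]
  set α := ((1 : Matrix a a ℂ) ⊗ₖ u) *ᵥ maxEntVec e with hα
  set β := star (maxEntVec e) ᵥ* ((1 : Matrix a a ℂ) ⊗ₖ v) with hβ
  have eα : ∀ i p, α (i, p) = u p (e i) := by
    intro i p
    simp [hα, Matrix.mulVec, dotProduct, Fintype.sum_prod_type, Matrix.one_apply, maxEntVec]
  have eβ : ∀ i p, β (i, p) = v (e i) p := by
    intro i p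
    simp [hβ, Matrix.vecMul, dotProduct, Fintype.sum_prod_type, Matrix.one_apply, maxEntVec]
  have h1 : star α ⬝ᵥ α = 1 := by
    rw [← trace_conjTranspose_mul_self_of_hilbertSchmidtNorm hu]
    simp only [dotProduct, Fintype.sum_prod_type, Pi.star_apply, eα, Matrix.trace,
      Matrix.diag_apply, Matrix.mul_apply, conjTranspose_apply]
    exact e.sum_comp fun i => ∑ p, star (u p i) * u p i
  have h2 : β ⬝ᵥ star β = 1 := by
    rw [← trace_conjTranspose_mul_self_of_hilbertSchmidtNorm hv]
    simp only [dotProduct, Fintype.sum_prod_type, Pi.star_apply, eβ, Matrix.trace,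
      Matrix.diag_apply, Matrix.mul_apply, conjTranspose_apply]
    rw [e.sum_comp fun i => ∑ p, v i p * star (v i p), Finset.sum_comm]
    simp only [mul_comm]
  have h3 : (vecMulVec α β)ᴴ * vecMulVec α β = vecMulVec (star β) β := by
    rw [conjTranspose_vecMulVec, vecMulVec_mul_vecMulVec, h1, one_smul]
  rw [traceNorm_eq_of_partial_isometry, h3, trace_vecMulVec, dotProduct_comm, h2]
  · simp
  · rw [h3, vecMulVec_mul_vecMulVec, h2, one_smul]

theorem operatorNorm_choi_le_cbNorm {n : ℕ} (e : a ≃ Fin n)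
    (T : Matrix a a ℂ →ₗ[ℂ] Matrix b b ℂ) :
    ENNReal.ofReal (operatorNorm (choi e T)) ≤ cbNorm T :=
  le_iSup_of_le n <| le_iSup_of_le _ <| le_iSup_of_le (matrixNormS1_maxEnt_le e) le_rfl

open scoped MatrixOrder Matrix.Norms.L2Operator in
theorem posSemidef_smul_one_sub {m : Type*} [Fintype m] [DecidableEq m] {J : Matrix m m ℂ}
    (hJ : J.IsHermitian) {c : ℝ} (hc : operatorNorm J ≤ c) :
    ((c : ℂ) • (1 : Matrix m m ℂ) - J).PosSemidef := by
  have h : J ≤ algebraMap ℝ (Matrix m m ℂ) ‖J‖ := IsSelfAdjoint.le_algebraMap_norm_self hJ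
  have h' : algebraMap ℝ (Matrix m m ℂ) ‖J‖ ≤ algebraMap ℝ (Matrix m m ℂ) c :=
    algebraMap_mono _ hc
  have h2 := Matrix.le_iff.1 (h.trans h')
  have e : (c : ℂ) • (1 : Matrix m m ℂ) = algebraMap ℝ (Matrix m m ℂ) c := by
    rw [Algebra.algebraMap_eq_smul_one]
    ext i j
    simp
  rw [e]
  exact h2

end

/-! ### Finiteness and positivity of the completely bounded norm -/

section

variable {a b : Type*} [Fintype a] [DecidableEq a] [Fintype b] [DecidableEq b]

theorem hilbertSchmidtNorm_eq {m : Type*} [Fintype m] (u : Matrix m m ℂ) :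
    hilbertSchmidtNorm u = Real.sqrt (∑ j, ∑ i, ‖u i j‖ ^ 2) := by
  simp only [hilbertSchmidtNorm, Matrix.trace, Matrix.diag_apply, ← sum_normSq_col,
    Complex.re_sum, Complex.ofReal_re, Complex.normSq_eq_norm_sq]

theorem traceNorm_le_one_of_matrixNormS1_le {n : ℕ} {X : Matrix (a × Fin n) (a × Fin n) ℂ}
    (hX : matrixNormS1 n X ≤ 1) {u v : Matrix (Fin n) (Fin n) ℂ} (hu : hilbertSchmidtNorm u = 1)
    (hv : hilbertSchmidtNorm v = 1) :
    traceNorm (((1 : Matrix a a ℂ) ⊗ₖ u) * X * ((1 : Matrix a a ℂ) ⊗ₖ v)) ≤ 1 := by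
  have h : ENNReal.ofReal (traceNorm (((1 : Matrix a a ℂ) ⊗ₖ u) * X * ((1 : Matrix a a ℂ) ⊗ₖ v)))
      ≤ matrixNormS1 n X :=
    le_iSup_of_le u <| le_iSup_of_le v <| le_iSup_of_le hu <| le_iSup_of_le hv le_rfl
  simpa using ENNReal.ofReal_le_one.1 (h.trans hX)

/-- The blocks of an element of the unit ball of `𝕄_n(S₁)` are contractions. -/
theorem norm_block_le {n : ℕ} {X : Matrix (a × Fin n) (a × Fin n) ℂ}
    (hX : matrixNormS1 n X ≤ 1) (i j : a) (ξ η : EuclideanSpace ℂ (Fin n)) :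
    ‖∑ p, ∑ q, ξ p * X (i, p) (j, q) * η q‖ ≤ ‖ξ‖ * ‖η‖ := by
  have unit : ∀ ξ η : EuclideanSpace ℂ (Fin n), ‖ξ‖ = 1 → ‖η‖ = 1 →
      ‖∑ p, ∑ q, ξ p * X (i, p) (j, q) * η q‖ ≤ 1 := by
    intro ξ η hξ hη
    have hne : Nonempty (Fin n) := by
      by_contra hne
      rw [not_nonempty_iff] at hne
      rw [EuclideanSpace.norm_eq] at hξ
      simp at hξ
    obtain ⟨r⟩ := hne
    -- With `ξ` as the only nonzero row of `u` and `η` as the only nonzero column of `v`, the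
    -- bilinear form of the block becomes the entry at `(i, r), (j, r)`.
    let u : Matrix (Fin n) (Fin n) ℂ := Matrix.of fun s p => if s = r then ξ p else 0
    let v : Matrix (Fin n) (Fin n) ℂ := Matrix.of fun q s => if s = r then η q else 0
    have hu : hilbertSchmidtNorm u = 1 := by
      rw [hilbertSchmidtNorm_eq, ← hξ, EuclideanSpace.norm_eq]
      simp [u, apply_ite]
    have hv : hilbertSchmidtNorm v = 1 := by
      rw [hilbertSchmidtNorm_eq, ← hη, EuclideanSpace.norm_eq, Finset.sum_comm]
      simp [v, apply_ite]
    have h := (norm_apply_le_traceNorm _ (i, r) (j, r)).trans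
      (traceNorm_le_one_of_matrixNormS1_le hX hu hv)
    refine le_trans (le_of_eq (congrArg _ ?_)) h
    simp only [Matrix.mul_apply, kroneckerMap_apply, Fintype.sum_prod_type, Matrix.one_apply,
      ite_mul, one_mul, zero_mul, mul_ite, mul_zero, u, v, Matrix.of_apply, Finset.sum_ite_irrel,
      Finset.sum_const_zero, Finset.sum_ite_eq, Finset.sum_ite_eq', Finset.mem_univ, if_true,
      Finset.sum_mul]
    exact Finset.sum_comm
  rcases eq_or_ne ξ 0 with rfl | hξ
  · simp
  rcases eq_or_ne η 0 with rfl | hη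
  · simp
  have hξ' : ‖ξ‖ ≠ 0 := norm_ne_zero_iff.2 hξ
  have hη' : ‖η‖ ≠ 0 := norm_ne_zero_iff.2 hη
  have h := unit (((‖ξ‖⁻¹ : ℝ) : ℂ) • ξ) (((‖η‖⁻¹ : ℝ) : ℂ) • η)
    (by simp [norm_smul, hξ']) (by simp [norm_smul, hη'])
  have e : ∑ p, ∑ q, (((‖ξ‖⁻¹ : ℝ) : ℂ) • ξ) p * X (i, p) (j, q) * (((‖η‖⁻¹ : ℝ) : ℂ) • η) q
      = ((‖ξ‖⁻¹ * ‖η‖⁻¹ : ℝ) : ℂ) * ∑ p, ∑ q, ξ p * X (i, p) (j, q) * η q := by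
    simp only [Finset.mul_sum]
    refine Finset.sum_congr rfl fun p _ => Finset.sum_congr rfl fun q _ => ?_
    simp only [PiLp.smul_apply, smul_eq_mul]
    push_cast
    ring
  rw [e, norm_mul, Complex.norm_real, Real.norm_of_nonneg (by positivity), ← mul_inv,
    inv_mul_le_iff₀ (by positivity), mul_one] at h
  exact h

theorem norm_slice_le {b : Type*} [Fintype b] {n : ℕ} (x : EuclideanSpace ℂ (b × Fin n))
    (hx : ‖x‖ = 1) (k : b) :
    ‖(WithLp.toLp 2 fun p => x (k, p) : EuclideanSpace ℂ (Fin n))‖ ≤ 1 := by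
  rw [← hx, EuclideanSpace.norm_eq, EuclideanSpace.norm_eq]
  refine Real.sqrt_le_sqrt ?_
  rw [Fintype.sum_prod_type]
  exact Finset.single_le_sum (f := fun k => ∑ p, ‖x (k, p)‖ ^ 2)
    (fun k _ => Finset.sum_nonneg fun p _ => by positivity) (Finset.mem_univ k)

/-- Expanding `T` over matrix units writes each matrix coefficient as a sum of entries of `T (single
i j 1)` times bilinear forms of the blocks of `X`, each at most one in modulus. The bound does not
depend on `n`, whence finiteness of `cbNorm`. -/
theorem operatorNorm_ampliation_le {n : ℕ} {X : Matrix (a × Fin n) (a × Fin n) ℂ}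
    (hX : matrixNormS1 n X ≤ 1) (T : Matrix a a ℂ →ₗ[ℂ] Matrix b b ℂ) :
    operatorNorm (ampliation (Fin n) T X)
      ≤ ∑ k, ∑ l, ∑ i, ∑ j, ‖T (Matrix.single i j 1) k l‖ := by
  refine ContinuousLinearMap.opNorm_le_of_re_inner_le (by positivity) fun x y hx hy => ?_
  have e : inner ℂ y (toEuclideanCLM (n := b × Fin n) (𝕜 := ℂ) (ampliation (Fin n) T X) x)
      = ∑ k, ∑ l, ∑ i, ∑ j, T (Matrix.single i j 1) k l *
        ∑ p, ∑ q, star (y (k, p)) * X (i, p) (j, q) * x (l, q) := by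
    have e1 : ∀ k l p q, ampliation (Fin n) T X (k, p) (l, q)
        = ∑ i, ∑ j, X (i, p) (j, q) * T (Matrix.single i j 1) k l := by
      intro k l p q
      simp only [ampliation, Matrix.of_apply]
      rw [map_eq_sum_single]
      simp only [Matrix.sum_apply, Matrix.smul_apply, smul_eq_mul, Matrix.of_apply]
    simp only [PiLp.inner_apply, Matrix.ofLp_toEuclideanCLM,
      Matrix.mulVec, dotProduct, Fintype.sum_prod_type, e1, RCLike.inner_apply]
    refine Finset.sum_congr rfl fun k _ => ?_
    simp only [Finset.sum_mul, Finset.mul_sum]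
    rw [Finset.sum_comm]
    refine Finset.sum_congr rfl fun l _ => ?_
    calc _ = ∑ p, ∑ q, ∑ i, ∑ j, T (Matrix.single i j 1) k l *
          (star (y (k, p)) * X (i, p) (j, q) * x (l, q)) := by
          refine Finset.sum_congr rfl fun p _ => Finset.sum_congr rfl fun q _ =>
            Finset.sum_congr rfl fun i _ => Finset.sum_congr rfl fun j _ => ?_
          rw [Complex.star_def]
          ring
      _ = ∑ p, ∑ i, ∑ j, ∑ q, T (Matrix.single i j 1) k l *
          (star (y (k, p)) * X (i, p) (j, q) * x (l, q)) := by
          refine Finset.sum_congr rfl fun p _ => ?_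
          rw [Finset.sum_comm]
          exact Finset.sum_congr rfl fun i _ => Finset.sum_comm
      _ = _ := by
          rw [Finset.sum_comm]
          exact Finset.sum_congr rfl fun i _ => Finset.sum_comm
  rw [← inner_conj_symm, RCLike.conj_re, e]
  refine (RCLike.re_le_norm _).trans ?_
  refine (norm_sum_le _ _).trans (Finset.sum_le_sum fun k _ => ?_)
  refine (norm_sum_le _ _).trans (Finset.sum_le_sum fun l _ => ?_)
  refine (norm_sum_le _ _).trans (Finset.sum_le_sum fun i _ => ?_)
  refine (norm_sum_le _ _).trans (Finset.sum_le_sum fun j _ => ?_)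
  rw [norm_mul]
  refine mul_le_of_le_one_right (norm_nonneg _) ?_
  have h1 : ‖(WithLp.toLp 2 fun p => star (y (k, p)) : EuclideanSpace ℂ (Fin n))‖ ≤ 1 := by
    refine le_trans (le_of_eq ?_) (norm_slice_le y hy k)
    simp [EuclideanSpace.norm_eq]
  exact (norm_block_le hX i j (WithLp.toLp 2 fun p => star (y (k, p)))
    (WithLp.toLp 2 fun q => x (l, q))).trans
      (mul_le_one₀ h1 (norm_nonneg _) (norm_slice_le x hx l))

theorem cbNorm_lt_top (T : Matrix a a ℂ →ₗ[ℂ] Matrix b b ℂ) : cbNorm T < ⊤ := by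
  refine lt_of_le_of_lt ?_ (ENNReal.ofReal_lt_top
    (r := ∑ k, ∑ l, ∑ i, ∑ j, ‖T (Matrix.single i j 1) k l‖))
  exact iSup_le fun n => iSup_le fun X => iSup_le fun hX =>
    ENNReal.ofReal_le_ofReal (operatorNorm_ampliation_le hX T)

/-- A vanishing norm forces the Choi matrix to vanish, and its entries determine `T`. -/
theorem cbNorm_pos {T : Matrix a a ℂ →ₗ[ℂ] Matrix b b ℂ} (hT : T ≠ 0) : 0 < cbNorm T := by
  rw [pos_iff_ne_zero]
  intro h0
  refine hT (LinearMap.ext fun X => ?_)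
  have h := operatorNorm_choi_le_cbNorm (Fintype.equivFin a) T
  rw [h0, nonpos_iff_eq_zero, ENNReal.ofReal_eq_zero] at h
  have h1 : choi (Fintype.equivFin a) T = 0 := by
    have := norm_le_zero_iff.1 h
    exact (EmbeddingLike.map_eq_zero_iff (f := toEuclideanCLM (n := b × Fin _) (𝕜 := ℂ))).1 this
  rw [map_eq_sum_single]
  ext x y
  simp [Matrix.sum_apply, ← choi_apply (Fintype.equivFin a), h1]

/-! ### The operator inequality -/

/-- The defect map `Y ↦ c tr(Y) 1 - T Y`. -/
noncomputable def traceDefect {a b : Type*} [Fintype a] [DecidableEq b] (c : ℂ)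
    (T : Matrix a a ℂ →ₗ[ℂ] Matrix b b ℂ) : Matrix a a ℂ →ₗ[ℂ] Matrix b b ℂ :=
  c • (Matrix.traceLinearMap a ℂ ℂ).smulRight (1 : Matrix b b ℂ) - T

/-- The Choi matrix of `Y ↦ tr(Y) 1` is the identity. -/
theorem choi_traceDefect {b : Type*} [DecidableEq b] {n : ℕ} (e : a ≃ Fin n) (c : ℂ)
    (T : Matrix a a ℂ →ₗ[ℂ] Matrix b b ℂ) :
    choi e (traceDefect c T) = c • (1 : Matrix (b × Fin n) (b × Fin n) ℂ) - choi e T := by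
  ext ⟨x, p⟩ ⟨y, q⟩
  obtain ⟨i, rfl⟩ := e.surjective p
  obtain ⟨j, rfl⟩ := e.surjective q
  rw [Matrix.sub_apply, choi_apply, choi_apply]
  simp only [traceDefect, LinearMap.sub_apply, LinearMap.smul_apply, LinearMap.smulRight_apply,
    Matrix.traceLinearMap_apply, Matrix.sub_apply, Matrix.smul_apply, smul_eq_mul,
    Matrix.one_apply, Prod.mk.injEq, e.injective.eq_iff]
  by_cases hij : i = j
  · subst hij; simp
  · simp [Matrix.trace_single_eq_of_ne _ _ _ hij, hij]

theorem ampliation_traceDefect {a b k : Type*} [Fintype a] [DecidableEq b] (c : ℂ)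
    (T : Matrix a a ℂ →ₗ[ℂ] Matrix b b ℂ) (Y : Matrix (a × k) (a × k) ℂ) :
    ampliation k (traceDefect c T) Y
      = c • ((1 : Matrix b b ℂ) ⊗ₖ partialTraceLeft Y) - ampliation k T Y := by
  ext ⟨x, p⟩ ⟨y, q⟩
  simp only [ampliation, traceDefect, LinearMap.sub_apply, LinearMap.smul_apply,
    LinearMap.smulRight_apply, Matrix.traceLinearMap_apply, Matrix.sub_apply, Matrix.smul_apply,
    smul_eq_mul, Matrix.of_apply, kroneckerMap_apply, partialTraceLeft, Matrix.trace,
    Matrix.diag_apply]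
  ring

/-- `(T ⊗ id)(Y) ≤ ‖T‖_cb 1 ⊗ tr_a(Y)` for completely positive `T` and `Y ≥ 0`. -/
theorem posSemidef_cbNorm_sub_ampliation {S : Type*} [Fintype S] {N : S → Matrix b a ℂ}
    {T : Matrix a a ℂ →ₗ[ℂ] Matrix b b ℂ} (hT : IsKraus N T) {k : Type*} [Fintype k]
    [DecidableEq k] {Y : Matrix (a × k) (a × k) ℂ} (hY : Y.PosSemidef) :
    (((cbNorm T).toReal : ℂ) • ((1 : Matrix b b ℂ) ⊗ₖ partialTraceLeft Y)
      - ampliation k T Y).PosSemidef := by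
  have hJ : (choi (Fintype.equivFin a) T).PosSemidef := by
    rw [choi, hT.ampliation_apply]
    exact posSemidef_kraus (posSemidef_vecMulVec_self_star _)
  have hc : operatorNorm (choi (Fintype.equivFin a) T) ≤ (cbNorm T).toReal :=
    (ENNReal.ofReal_le_iff_le_toReal (cbNorm_lt_top T).ne).1 (operatorNorm_choi_le_cbNorm _ T)
  have h := posSemidef_smul_one_sub hJ.1 hc
  -- The norm bound on the Choi matrix is thus complete positivity of the defect map, and its Kraus
  -- operators give positivity over an arbitrary finite index type `k`.
  rw [← choi_traceDefect] at h
  obtain ⟨D, hD⟩ := exists_isKraus_of_choi _ _ h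
  rw [← ampliation_traceDefect, hD.ampliation_apply]
  exact posSemidef_kraus hY

end

/-! ### Marginals, the limit in ε, and the conclusion -/

theorem partialTraceLeft_conj_kronecker {b c : Type*} [Fintype b] [DecidableEq b] [Fintype c]
    (Q : Matrix c c ℂ) (X : Matrix (b × c) (b × c) ℂ) :
    partialTraceLeft (((1 : Matrix b b ℂ) ⊗ₖ Q)ᴴ * X * ((1 : Matrix b b ℂ) ⊗ₖ Q))
      = Qᴴ * partialTraceLeft X * Q := by
  ext p q
  simp only [partialTraceLeft, Matrix.of_apply, Matrix.mul_apply, conjTranspose_apply,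
    kroneckerMap_apply, Fintype.sum_prod_type, Matrix.one_apply, ite_mul, one_mul, zero_mul,
    mul_ite, mul_zero, Finset.sum_ite_irrel, Finset.sum_const_zero,
    Finset.sum_ite_eq', Finset.mem_univ, if_true, apply_ite star, star_zero, Finset.sum_mul,
    Finset.mul_sum]
  rw [Finset.sum_comm]
  refine Finset.sum_congr rfl fun r _ => ?_
  rw [Finset.sum_comm]

theorem posSemidef_partialTraceLeft {m c : Type*} [Fintype m] [Fintype c]
    {ρ : Matrix (m × c) (m × c) ℂ} (h : ρ.PosSemidef) : (partialTraceLeft ρ).PosSemidef := by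
  have e : partialTraceLeft ρ = ∑ i, ρ.submatrix (fun p => (i, p)) (fun p => (i, p)) := by
    ext p q
    simp [partialTraceLeft, Matrix.sum_apply]
  rw [e]
  exact posSemidef_sum _ fun i _ => h.submatrix _

theorem trace_partialTraceLeft {m c : Type*} [Fintype m] [Fintype c]
    (ρ : Matrix (m × c) (m × c) ℂ) : (partialTraceLeft ρ).trace = ρ.trace := by
  simp only [partialTraceLeft, Matrix.trace, Matrix.diag_apply, Matrix.of_apply,
    Fintype.sum_prod_type]
  exact Finset.sum_comm

open Filter Topology in
theorem tendsto_sum_mul_log {ι : Type*} [Fintype ι] (r : ι → ℝ) {c : ℝ} (hc : 0 < c) (d : ℝ) :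
    Tendsto (fun ε : ℝ => ∑ i, r i * Real.log (c * (r i + d * ε))) (𝓝[>] 0)
      (𝓝 (∑ i, r i * (Real.log c + Real.log (r i)))) := by
  refine tendsto_finsetSum _ fun i _ => ?_
  rcases eq_or_ne (r i) 0 with h | h
  -- Terms with `r i = 0` vanish for every `ε`, so the discontinuity of `log` at 0 does no harm.
  · simp [h]
  refine Tendsto.const_mul _ ?_
  rw [← Real.log_mul hc.ne' h]
  refine Tendsto.mono_left ?_ nhdsWithin_le_nhds
  have h1 : Tendsto (fun ε : ℝ => c * (r i + d * ε)) (𝓝 0) (𝓝 (c * (r i + d * 0))) :=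
    Continuous.tendsto (by fun_prop) 0
  rw [mul_zero, add_zero] at h1
  exact (Real.continuousAt_log (mul_ne_zero hc.ne' h)).tendsto.comp h1

section

variable {M A B C : Type*} [Fintype M] [DecidableEq M] [Fintype A] [DecidableEq A]
  [Fintype B] [DecidableEq B] [Fintype C] [DecidableEq C]
  {ΦA : Matrix M M ℂ →ₗ[ℂ] Matrix A A ℂ} {ΦB : Matrix M M ℂ →ₗ[ℂ] Matrix B B ℂ}

theorem nonempty_of_isDensityOperator {m : Type*} [Fintype m] {ρ : Matrix m m ℂ}
    (hρ : IsDensityOperator ρ) : Nonempty m := by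
  by_contra h
  rw [not_nonempty_iff] at h
  have := hρ.trace_eq_one
  simp [Matrix.trace] at this

theorem IsQuantumChannel.nonempty {A : Type*} [Fintype A]
    {ΦA : Matrix M M ℂ →ₗ[ℂ] Matrix A A ℂ} [Nonempty M] (hA : IsQuantumChannel ΦA) : Nonempty A := by
  by_contra h
  rw [not_nonempty_iff] at h
  have := hA.trace_map 1
  rw [Matrix.trace_one] at this
  simp [Matrix.trace, eq_comm] at this

/-- The adjoint of `ΦA` is unital and `ΦB` preserves the trace, so the image of 1 has trace `dim M ≠
0`. -/
theorem comp_traceAdjoint_ne_zero {B : Type*} [Fintype B]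
    {ΦB : Matrix M M ℂ →ₗ[ℂ] Matrix B B ℂ} [Nonempty M] (hA : IsQuantumChannel ΦA)
    (hB : IsQuantumChannel ΦB) : ΦB ∘ₗ traceAdjoint ΦA ≠ 0 := by
  obtain ⟨K, hK⟩ := hA.completelyPositive.exists_isKraus
  intro h
  have h1 := congrArg Matrix.trace (LinearMap.congr_fun h 1)
  rw [LinearMap.comp_apply, hB.trace_map, hK.traceAdjoint_apply] at h1
  simp only [Matrix.mul_one, hK.sum_conjTranspose_mul hA.trace_map] at h1
  simp at h1

theorem ampliation_comp {m a b : Type*} (k : Type*) (Φ : Matrix m m ℂ →ₗ[ℂ] Matrix a a ℂ)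
    (Ψ : Matrix a a ℂ →ₗ[ℂ] Matrix b b ℂ) (X : Matrix (m × k) (m × k) ℂ) :
    ampliation k (Ψ ∘ₗ Φ) X = ampliation k Ψ (ampliation k Φ X) := rfl

theorem IsKraus.ampliation_traceAdjoint_apply {A S : Type*} [Fintype A]
    {ΦA : Matrix M M ℂ →ₗ[ℂ] Matrix A A ℂ} [Fintype S] {K : S → Matrix A M ℂ}
    (h : IsKraus K ΦA) (Y : Matrix (A × C) (A × C) ℂ) :
    ampliation C (traceAdjoint ΦA) Y
      = ∑ s, (K s ⊗ₖ (1 : Matrix C C ℂ))ᴴ * Y * (K s ⊗ₖ (1 : Matrix C C ℂ)) := by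
  have h' : IsKraus (fun s => (K s)ᴴ) (traceAdjoint ΦA) := fun Y => by
    simp only [h.traceAdjoint_apply, conjTranspose_conjTranspose]
  rw [h'.ampliation_apply]
  simp [conjTranspose_kronecker]

theorem entropy_uncertainty (hA : IsQuantumChannel ΦA) (hB : IsQuantumChannel ΦB)
    {ρ : Matrix (M × C) (M × C) ℂ} (hρ : IsDensityOperator ρ) {c : ℝ}
    (hc : c = (cbNorm (ΦB ∘ₗ traceAdjoint ΦA)).toReal) (hc0 : 0 < c) :
    vonNeumannEntropy ρ + vonNeumannEntropy (partialTraceLeft ρ) - Real.log c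
      ≤ vonNeumannEntropy (ampliation C ΦA ρ) + vonNeumannEntropy (ampliation C ΦB ρ) := by
  obtain ⟨⟨i₀, -⟩⟩ := nonempty_of_isDensityOperator hρ
  have : Nonempty M := ⟨i₀⟩
  have : Nonempty A := hA.nonempty
  obtain ⟨K, hK⟩ := hA.completelyPositive.exists_isKraus
  obtain ⟨L, hL⟩ := hB.completelyPositive.exists_isKraus
  obtain ⟨Q, r, hQ, hr, hCQ, hCf⟩ :=
    exists_diagonalization (posSemidef_partialTraceLeft hρ.posSemidef)
  have hZ : ((1 : Matrix B B ℂ) ⊗ₖ Q)ᴴ * ((1 : Matrix B B ℂ) ⊗ₖ Q) = 1 := by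
    rw [conjTranspose_kronecker, ← mul_kronecker_mul, hQ, conjTranspose_one, Matrix.mul_one,
      one_kronecker_one]
  have hd : (0 : ℝ) < Fintype.card A := by exact_mod_cast Fintype.card_pos
  have key : ∀ ε : ℝ, 0 < ε → -vonNeumannEntropy (ampliation C ΦB ρ)
      - ∑ q, r q * Real.log (c * (r q + Fintype.card A * ε))
      ≤ vonNeumannEntropy (ampliation C ΦA ρ) - vonNeumannEntropy ρ := by
    intro ε hε
    have hY : (ampliation C ΦA ρ + (ε : ℂ) • (1 : Matrix (A × C) (A × C) ℂ)).PosSemidef := by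
      refine PosSemidef.add ?_ (PosSemidef.one.smul (by exact_mod_cast hε.le))
      rw [hK.ampliation_apply]
      exact posSemidef_kraus hρ.posSemidef
    -- The factor `card A` is the trace of the identity on `A`.
    have hYC : partialTraceLeft (ampliation C ΦA ρ + (ε : ℂ) • (1 : Matrix (A × C) (A × C) ℂ))
        = partialTraceLeft ρ + ((Fintype.card A * ε : ℝ) : ℂ) • (1 : Matrix C C ℂ) := by
      rw [← partialTraceLeft_ampliation hA.trace_map ρ]
      ext p q
      by_cases hpq : p = q <;>
        simp [partialTraceLeft, Finset.sum_add_distrib, Matrix.one_apply, hpq]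
    have hdiag : (c : ℂ) • ((1 : Matrix B B ℂ) ⊗ₖ
          (partialTraceLeft ρ + ((Fintype.card A * ε : ℝ) : ℂ) • (1 : Matrix C C ℂ)))
        = ((1 : Matrix B B ℂ) ⊗ₖ Q)
          * diagonal (fun k : B × C => ((c * (r k.2 + Fintype.card A * ε) : ℝ) : ℂ))
          * ((1 : Matrix B B ℂ) ⊗ₖ Q)ᴴ := by
      have e1 : partialTraceLeft ρ + ((Fintype.card A * ε : ℝ) : ℂ) • (1 : Matrix C C ℂ)
          = Q * diagonal (fun q => ((r q + Fintype.card A * ε : ℝ) : ℂ)) * Qᴴ := by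
        rw [hCQ, conj_diagonal_add_smul_one hQ]
      have e2 : diagonal (fun k : B × C => ((c * (r k.2 + Fintype.card A * ε) : ℝ) : ℂ))
          = (c : ℂ) • ((1 : Matrix B B ℂ) ⊗ₖ
            diagonal (fun q => ((r q + Fintype.card A * ε : ℝ) : ℂ))) := by
        rw [← Matrix.diagonal_one, diagonal_kronecker_diagonal, ← Matrix.diagonal_smul]
        congr 1
        ext k
        simp
      rw [e1, e2, Matrix.mul_smul, Matrix.smul_mul, conjTranspose_kronecker,
        ← mul_kronecker_mul, ← mul_kronecker_mul, conjTranspose_one, Matrix.mul_one,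
        Matrix.mul_one]
    have hpsd := posSemidef_cbNorm_sub_ampliation (hK.comp_traceAdjoint hL) hY
    rw [← hc, hYC, hdiag, ampliation_comp, hL.ampliation_apply,
      hK.ampliation_traceAdjoint_apply, hK.ampliation_apply] at hpsd
    have main := relEntropy_le_entropy_gain
      (sum_conjTranspose_mul_kronecker_one (hK.sum_conjTranspose_mul hA.trace_map))
      (sum_conjTranspose_mul_kronecker_one (hL.sum_conjTranspose_mul hB.trace_map))
      hρ.posSemidef hε hZ (fun k => mul_pos hc0 (add_pos_of_nonneg_of_pos (hr k.2)
        (mul_pos hd hε))) hpsd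
    rw [← hK.ampliation_apply, ← hL.ampliation_apply] at main
    -- The comparison operator `c · 1 ⊗ (ρ_C + card A · ε)` has eigenvalues independent of the `B`
    -- index, so only the `C`-marginal of `ΦB ρ` enters, and this is `ρ_C`.
    have hsum : ∀ q, ∑ k, ((((1 : Matrix B B ℂ) ⊗ₖ Q)ᴴ * ampliation C ΦB ρ
        * ((1 : Matrix B B ℂ) ⊗ₖ Q)) (k, q) (k, q)).re = r q := by
      intro q
      have h := congrFun (congrFun (partialTraceLeft_conj_kronecker Q (ampliation C ΦB ρ)) q) q
      rw [partialTraceLeft_ampliation hB.trace_map] at h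
      have h' := congrArg Complex.re h
      rw [hCQ, diag_conj_diagonal hQ, partialTraceLeft, Matrix.of_apply, Complex.re_sum] at h'
      exact h'
    rw [Fintype.sum_prod_type, Finset.sum_comm] at main
    simp only [← Finset.sum_mul, hsum] at main
    exact main
  have hlim := tendsto_sum_mul_log r hc0 (Fintype.card A)
  have hfin : -vonNeumannEntropy (ampliation C ΦB ρ) - ∑ q, r q * (Real.log c + Real.log (r q))
      ≤ vonNeumannEntropy (ampliation C ΦA ρ) - vonNeumannEntropy ρ := by
    refine le_of_tendsto (hlim.const_sub _) ?_
    filter_upwards [self_mem_nhdsWithin] with ε hε using key ε hε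
  have hr1 : ∑ q, r q = 1 := by
    have h := trace_partialTraceLeft ρ
    rw [hρ.trace_eq_one, hCQ, trace_unitary_conj hQ, trace_diagonal] at h
    exact_mod_cast h
  simp only [mul_add, Finset.sum_add_distrib, ← Finset.sum_mul, hr1, one_mul] at hfin
  rw [vonNeumannEntropy_eq hQ hCQ hCf]
  linarith

end

end ChannelUncertainty

theorem theorem4p1 {M A B C : Type*}
    [Fintype M] [DecidableEq M] [Fintype A] [DecidableEq A]
    [Fintype B] [DecidableEq B] [Fintype C] [DecidableEq C]
    (ΦA : Matrix M M ℂ →ₗ[ℂ] Matrix A A ℂ) (ΦB : Matrix M M ℂ →ₗ[ℂ] Matrix B B ℂ)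
    (hA : ChannelUncertainty.IsQuantumChannel ΦA)
    (hB : ChannelUncertainty.IsQuantumChannel ΦB)
    (ρ : Matrix (M × C) (M × C) ℂ) (hρ : ChannelUncertainty.IsDensityOperator ρ) :
    0 < ChannelUncertainty.cbNorm (ΦB ∘ₗ ChannelUncertainty.traceAdjoint ΦA) ∧
    ChannelUncertainty.cbNorm (ΦB ∘ₗ ChannelUncertainty.traceAdjoint ΦA) < ⊤ ∧
    ChannelUncertainty.condEntropy (ChannelUncertainty.ampliation C ΦA ρ)
        + ChannelUncertainty.condEntropy (ChannelUncertainty.ampliation C ΦB ρ)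
      ≥ ChannelUncertainty.condEntropy ρ
        + Real.log (1 /
          (ChannelUncertainty.cbNorm (ΦB ∘ₗ ChannelUncertainty.traceAdjoint ΦA)).toReal) := by
  obtain ⟨⟨i₀, -⟩⟩ := ChannelUncertainty.nonempty_of_isDensityOperator hρ
  have : Nonempty M := ⟨i₀⟩
  have hpos := ChannelUncertainty.cbNorm_pos
    (ChannelUncertainty.comp_traceAdjoint_ne_zero hA hB)
  have htop := ChannelUncertainty.cbNorm_lt_top (ΦB ∘ₗ ChannelUncertainty.traceAdjoint ΦA)
  refine ⟨hpos, htop, ?_⟩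
  have h := ChannelUncertainty.entropy_uncertainty hA hB hρ rfl
    (ENNReal.toReal_pos hpos.ne' htop.ne)
  -- All three conditional entropies subtract the same `S(ρ_C)`: two copies on the left and one on
  -- the right, which accounts for the extra `S(ρ_C)` in `entropy_uncertainty`.
  simp only [ChannelUncertainty.condEntropy,
    ChannelUncertainty.partialTraceLeft_ampliation hA.trace_map,
    ChannelUncertainty.partialTraceLeft_ampliation hB.trace_map]
  rw [one_div, Real.log_inv]
  linarith
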